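/- Let $f:[0,1]\to\mathbb R$ be continuous with $f(0)=f(1)=0$, and suppose there is $k>0$ with $|f(s)|\le ks$ and $|f(s)|\le k(1-s)$ for all $s\in[0,1]$. Call $f$ - of type A if $f>0$ on $(0,1)$; - a KPP reaction term if it is of type A, $f'(0)$ (the one-sided derivative) exists, and $f(s)\le f'(0)s$ on $[0,1]$; - of type B if, for some $\alpha\in(0,1)$, $f=0$ on $[0,\alpha]$ and $f>0$ on $(\alpha,1)$; - of type C if, for some $\alpha\in(0,1)$, $f<0$ on $(0,\alpha)$, $f>0$ on $(\alpha,1)$, and $\int_0^1 f(s)\,ds\ge 0$. For $\gamma>0$, a front with speed $c\in\mathbb R$ is a nondecreasing $v\in C^2(\mathbb R)$ with $v(-\infty)=0$, $v(+\infty)=1$, $\gamma|v'|<1$ and $$\Big(\frac{v'}{\sqrt{1-\gamma^2 (v')^2}}\Big)'-c\,v'+f(v)=0\quad\text{on }\mathbb R .$$ A linear front with speed $c$ is a nondecreasing $v\in C^2(\mathbb R)$ with $v(-\infty)=0$, $v(+\infty)=1$ and $v''-cv'+f(v)=0$ on $\mathbb R$. A speed is admissible if a front (respectively, a linear front) with that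 speed exists. The critical speeds $c^*_\gamma$ and $c^*_L$ are the infima of the respective sets of admissible speeds. Let $\mathcal V_0=1/2$ if $f$ is of type A, and $\mathcal V_0=\alpha$ if $f$ is of type B or C. 1. Suppose $f$ is a KPP reaction term. Then for every $\gamma>0$ the set of admissible speeds is $[c^*_\gamma,+\infty)$, and the set of linear admissible speeds is $[c^*_L,+\infty)$. There are exactly one front $v_\gamma$ with speed $c_\gamma^*$ and $v_\gamma(0)=\mathcal V_0$, and exactly one linear front $v_L$ with speed $c_L^*$ and $v_L(0)=\mathcal V_0$. Moreover $$\lim_{\gamma\to0^+}c_\gamma^*=c_L^*=2\sqrt{f'(0)},\qquad \lim_{\gamma\to0^+}v_\gamma=v_L .$$ 2. Suppose $f$ is of type B or C. Then for every $\gamma>0$ the only admissible speed is $c^*_\gamma$, and the only linear admissible speed is $c_L^*$. There are exactly one front $v_\gamma$ with speed $c_\gamma^*$ and $v_\gamma(0)=\mathcal V_0$, and exactly one linear front $v_L$ with speed $c_L^*$ and $v_L(0)=\mathcal V_0$. Moreover $$\lim_{\gamma\to0^+}c_\gamma^*=c_L^*,\qquad \lim_{\gamma\to0^+}v_\gamma=v_L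 .$$ In both cases the convergence of $v_\gamma$ to $v_L$ is $C^2$ on the whole of $\mathbb R$: $v_\gamma\to v_L$, $v_\gamma'\to v_L'$ and $v_\gamma''\to v_L''$ uniformly on $\mathbb R$. -/

import Mathlib

open Set Filter Topology MeasureTheory

namespace BornInfeld

/-- Standing assumption on the reaction term. Only the values of `f` on `[0, 1]` are ever used. -/
structure IsReactionTerm (f : ℝ → ℝ) : Prop where
  continuousOn : ContinuousOn f (Icc 0 1)
  map_zero : f 0 = 0
  map_one : f 1 = 0
  linear_control : ∃ k : ℝ, 0 < k ∧ ∀ s ∈ Icc (0 : ℝ) 1, |f s| ≤ k * s ∧ |f s| ≤ k * (1 - s)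

/-- Type A (monostable). -/
def TypeA (f : ℝ → ℝ) : Prop :=
  ∀ s ∈ Ioo (0 : ℝ) 1, 0 < f s

/-- Type B (combustion), with ignition threshold `α`. -/
def TypeB (f : ℝ → ℝ) (α : ℝ) : Prop :=
  α ∈ Ioo (0 : ℝ) 1 ∧ (∀ s ∈ Icc 0 α, f s = 0) ∧ ∀ s ∈ Ioo α 1, 0 < f s

/-- Type C (bistable), with intermediate zero `α`. -/
def TypeC (f : ℝ → ℝ) (α : ℝ) : Prop :=
  α ∈ Ioo (0 : ℝ) 1 ∧ (∀ s ∈ Ioo 0 α, f s < 0) ∧ (∀ s ∈ Ioo α 1, 0 < f s) ∧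
    0 ≤ ∫ s in (0 : ℝ)..1, f s

/-- `f` is a KPP reaction term (of type A) and `m` is its one-sided derivative at `0`. -/
def KPP (f : ℝ → ℝ) (m : ℝ) : Prop :=
  TypeA f ∧ HasDerivWithinAt f m (Icc 0 1) 0 ∧ ∀ s ∈ Icc (0 : ℝ) 1, f s ≤ m * s

/-- A `C²` monotone function on the line connecting `0` (at `-∞`) and `1` (at `+∞`). -/
structure IsConnection (v : ℝ → ℝ) : Prop where
  contDiff : ContDiff ℝ 2 v
  monotone : Monotone v
  tendsto_atBot : Tendsto v atBot (𝓝 0)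
  tendsto_atTop : Tendsto v atTop (𝓝 1)

/-- `v` is a monotone heteroclinic solution, connecting `0` and `1`, of
`(v' / √(1 - γ² v'²))' - c v' + f(v) = 0`. -/
structure IsFront (γ c : ℝ) (f v : ℝ → ℝ) : Prop extends IsConnection v where
  field_lt : ∀ z, γ ^ 2 * deriv v z ^ 2 < 1
  equation : ∀ z,
    deriv (fun x => deriv v x / √(1 - γ ^ 2 * deriv v x ^ 2)) z - c * deriv v z + f (v z) = 0

/-- `v` is a monotone heteroclinic solution, connecting `0` and `1`, of `v'' - c v' + f(v) = 0`. -/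
structure IsLinearFront (c : ℝ) (f v : ℝ → ℝ) : Prop extends IsConnection v where
  equation : ∀ z, deriv (deriv v) z - c * deriv v z + f (v z) = 0

/-- Speeds at which a monotone front of the equation with parameter `γ` travels. -/
def admissibleSpeeds (γ : ℝ) (f : ℝ → ℝ) : Set ℝ :=
  {c | ∃ v, IsFront γ c f v}

/-- Speeds at which a monotone front of the linear diffusion equation travels. -/
def linearAdmissibleSpeeds (f : ℝ → ℝ) : Set ℝ :=
  {c | ∃ v, IsLinearFront c f v}

/-- The critical speed `c*_γ`. -/
noncomputable def criticalSpeed (γ : ℝ) (f : ℝ → ℝ) : ℝ :=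
  sInf (admissibleSpeeds γ f)

/-- The critical speed `c*_L` of the linear diffusion equation. -/
noncomputable def linearCriticalSpeed (f : ℝ → ℝ) : ℝ :=
  sInf (linearAdmissibleSpeeds f)

/-- `v` is the only critical front profile with parameter `γ` taking the value `V₀` at `0`. -/
def IsTheCriticalProfile (γ : ℝ) (f : ℝ → ℝ) (V₀ : ℝ) (v : ℝ → ℝ) : Prop :=
  ∀ w : ℝ → ℝ, (IsFront γ (criticalSpeed γ f) f w ∧ w 0 = V₀) ↔ w = v

/-- `v` is the only critical front profile of the linear diffusion equation with value `V₀`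
at `0`. -/
def IsTheLinearCriticalProfile (f : ℝ → ℝ) (V₀ : ℝ) (v : ℝ → ℝ) : Prop :=
  ∀ w : ℝ → ℝ, (IsLinearFront (linearCriticalSpeed f) f w ∧ w 0 = V₀) ↔ w = v

/-- `C²` convergence on the whole line as `γ → 0⁺`: uniform convergence on `ℝ` of the functions
and of their first and second derivatives. -/
def TendstoC2 (v : ℝ → ℝ → ℝ) (vL : ℝ → ℝ) : Prop :=
  ∀ k : ℕ, k ≤ 2 →
    TendstoUniformly (fun γ => iteratedDeriv k (v γ)) (iteratedDeriv k vL) (𝓝[>] (0 : ℝ))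

end BornInfeld

/-! Write the equation as a first order system for the profile `v` and the flux `w`, where `v' =
velocity γ w`. Along a front `v` increases, so the energy `y` of the flux can be regarded as a
function of `s = v`. It solves the scalar terminal value problem `y' = c * slope γ y - f`, `y 1 =
0`. At `γ = 0` the slope is `√(2y)` and the equation is the linear one, so all results are proved
for `γ ≥ 0` and the linear case is not treated separately.

The slope has a square-root corner at `y = 0`, but it is nondecreasing. Solving backwards from `1`,
monotonicity alone gives comparison, uniqueness and continuous dependence
(`IsTerminalSolution.le_add`, `abs_sub_le`). Hence `y` is nonincreasing in `c` and continuous in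
`(γ, c)`. A front of speed `c` exists exactly when `c ≥ 0`, `y 0 = 0` and `y > 0` on `(0, 1)`
(`HasFrontEnergy`, `isFront_iff`), and the critical speed is the least `c ≥ 0` with `y 0 ≤ 0`.

For type A, positivity on `(0, 1)` is automatic, so the admissible speeds form a half-line. For KPP
terms a quadratic supersolution and the linearisation at `0` squeeze the critical speed to `2√m`.
For types B and C, the momentum equation `q' = c - f / slope`, with `f ≤ 0` on `[0, α]`, forbids two
admissible speeds. The same uniqueness, together with a lower bound on positive energies that
survives limits, gives convergence of the critical speeds.

The profile is recovered from `v' = slope γ (y v)`. Linear bounds on the right side at `0` and `1`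
make both ends infinitely far in time. Time maps converge by dominated convergence, so their
inverses converge pointwise; monotonicity upgrades this to uniform convergence. The first two
derivatives are fixed continuous functions of `γ`, the energy, the speed and `v`, so they converge
uniformly too. -/

namespace BornInfeld

/-! ### Flux, slope, energy and momentum. -/

/-- The slope `p` as a function of the flux `q = p / √(1 - γ² p²)`. -/
noncomputable def velocity (γ q : ℝ) : ℝ := q / √(1 + γ ^ 2 * q ^ 2)

/-- The primitive of `velocity γ` vanishing at `0`. -/
noncomputable def energy (γ q : ℝ) : ℝ := q ^ 2 / (1 + √(1 + γ ^ 2 * q ^ 2))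

/-- The inverse of `energy γ` on the half line, extended by `0`. -/
noncomputable def momentum (γ y : ℝ) : ℝ := √(2 * max y 0 + γ ^ 2 * max y 0 ^ 2)

/-- The slope as a function of the energy, extended by `0`. -/
noncomputable def slope (γ y : ℝ) : ℝ := momentum γ y / (1 + γ ^ 2 * max y 0)

variable {γ q y : ℝ}

lemma one_add_sq_pos (γ q : ℝ) : 0 < 1 + γ ^ 2 * q ^ 2 := by positivity

lemma sqrt_one_add_sq_pos (γ q : ℝ) : 0 < √(1 + γ ^ 2 * q ^ 2) :=
  Real.sqrt_pos.2 (one_add_sq_pos γ q)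

lemma one_le_sqrt_one_add_sq (γ q : ℝ) : 1 ≤ √(1 + γ ^ 2 * q ^ 2) := by
  rw [Real.one_le_sqrt]; nlinarith [mul_nonneg (sq_nonneg γ) (sq_nonneg q)]

lemma hasDerivAt_sqrt_one_add_sq (γ q : ℝ) :
    HasDerivAt (fun q => √(1 + γ ^ 2 * q ^ 2)) (γ ^ 2 * q / √(1 + γ ^ 2 * q ^ 2)) q := by
  have h := (((hasDerivAt_pow 2 q).const_mul (γ ^ 2)).const_add 1).sqrt (one_add_sq_pos γ q).ne'
  convert h using 1
  have := (sqrt_one_add_sq_pos γ q).ne'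
  field_simp
  norm_num
  ring

/-- The form `q² / (1 + √(1 + γ²q²))` of the energy, instead of the equal `(√(1 + γ²q²) - 1) / γ²`,
keeps `γ = 0` inside every formula. -/
lemma hasDerivAt_energy (γ q : ℝ) : HasDerivAt (energy γ) (velocity γ q) q := by
  have hu := sqrt_one_add_sq_pos γ q
  have hs : √(1 + γ ^ 2 * q ^ 2) ^ 2 = 1 + γ ^ 2 * q ^ 2 := Real.sq_sqrt (one_add_sq_pos γ q).le
  have h := (hasDerivAt_pow 2 q).div ((hasDerivAt_sqrt_one_add_sq γ q).const_add 1)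
    (by positivity)
  refine h.congr_deriv ?_
  rw [velocity]
  set u := √(1 + γ ^ 2 * q ^ 2)
  field_simp
  push_cast
  linear_combination q * hs

lemma hasDerivAt_velocity (γ q : ℝ) :
    HasDerivAt (velocity γ) (1 / √(1 + γ ^ 2 * q ^ 2) ^ 3) q := by
  have hu := sqrt_one_add_sq_pos γ q
  have hs : √(1 + γ ^ 2 * q ^ 2) ^ 2 = 1 + γ ^ 2 * q ^ 2 := Real.sq_sqrt (one_add_sq_pos γ q).le
  have h := (hasDerivAt_id q).div (hasDerivAt_sqrt_one_add_sq γ q) hu.ne'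
  refine h.congr_deriv ?_
  simp only [id]
  set u := √(1 + γ ^ 2 * q ^ 2)
  field_simp
  linear_combination hs

lemma velocity_strictMono (γ : ℝ) : StrictMono (velocity γ) := by
  apply strictMono_of_deriv_pos
  intro q
  rw [(hasDerivAt_velocity γ q).deriv]
  have := sqrt_one_add_sq_pos γ q
  positivity

lemma velocity_zero (γ : ℝ) : velocity γ 0 = 0 := by simp [velocity]

lemma velocity_nonneg (hq : 0 ≤ q) : 0 ≤ velocity γ q := by
  rw [velocity]; positivity

lemma velocity_pos_iff : 0 < velocity γ q ↔ 0 < q := by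
  simpa only [velocity_zero] using (velocity_strictMono γ).lt_iff_lt (a := 0) (b := q)

lemma velocity_le (hq : 0 ≤ q) : velocity γ q ≤ q :=
  div_le_self hq (one_le_sqrt_one_add_sq γ q)

lemma continuous_velocity (γ : ℝ) : Continuous (velocity γ) :=
  continuous_iff_continuousAt.2 fun q => (hasDerivAt_velocity γ q).continuousAt

lemma continuous_energy (γ : ℝ) : Continuous (energy γ) :=
  continuous_iff_continuousAt.2 fun q => (hasDerivAt_energy γ q).continuousAt

lemma energy_zero (γ : ℝ) : energy γ 0 = 0 := by simp [energy]

lemma energy_nonneg (γ q : ℝ) : 0 ≤ energy γ q := by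
  rw [energy]; positivity

lemma one_sub_velocity_sq (γ q : ℝ) :
    1 - γ ^ 2 * velocity γ q ^ 2 = 1 / (1 + γ ^ 2 * q ^ 2) := by
  have := one_add_sq_pos γ q
  rw [velocity, div_pow, Real.sq_sqrt this.le]
  field_simp
  ring

lemma velocity_flux {p : ℝ} (hp : γ ^ 2 * p ^ 2 < 1) :
    velocity γ (p / √(1 - γ ^ 2 * p ^ 2)) = p := by
  have h : 0 < 1 - γ ^ 2 * p ^ 2 := by linarith
  have hs := Real.sqrt_pos.2 h
  rw [velocity, div_pow, Real.sq_sqrt h.le]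
  have : 1 + γ ^ 2 * (p ^ 2 / (1 - γ ^ 2 * p ^ 2)) = 1 / (1 - γ ^ 2 * p ^ 2) := by
    field_simp; ring
  rw [this, Real.sqrt_div zero_le_one, Real.sqrt_one]
  set u := √(1 - γ ^ 2 * p ^ 2)
  field_simp

lemma flux_velocity (γ q : ℝ) :
    velocity γ q / √(1 - γ ^ 2 * velocity γ q ^ 2) = q := by
  have := sqrt_one_add_sq_pos γ q
  rw [one_sub_velocity_sq, Real.sqrt_div zero_le_one, Real.sqrt_one, velocity]
  field_simp

lemma momentum_of_nonneg (hy : 0 ≤ y) : momentum γ y = √(2 * y + γ ^ 2 * y ^ 2) := by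
  rw [momentum, max_eq_left hy]

lemma momentum_nonneg (γ y : ℝ) : 0 ≤ momentum γ y := Real.sqrt_nonneg _

lemma continuous_momentum (γ : ℝ) : Continuous (momentum γ) := by
  unfold momentum; fun_prop

lemma momentum_mono (γ : ℝ) : Monotone (momentum γ) := by
  intro a b h
  have h1 : max a 0 ≤ max b 0 := max_le_max_right 0 h
  have h0 : 0 ≤ max a 0 := le_max_right _ _
  exact Real.sqrt_le_sqrt (by gcongr)

lemma sqrt_one_add_momentum_sq (hy : 0 ≤ y) :
    √(1 + γ ^ 2 * momentum γ y ^ 2) = 1 + γ ^ 2 * y := by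
  rw [momentum_of_nonneg hy, Real.sq_sqrt (by positivity)]
  rw [show 1 + γ ^ 2 * (2 * y + γ ^ 2 * y ^ 2) = (1 + γ ^ 2 * y) ^ 2 by ring]
  exact Real.sqrt_sq (by positivity)

lemma momentum_max (γ y : ℝ) : momentum γ (max y 0) = momentum γ y := by
  simp [momentum]

lemma velocity_momentum (γ y : ℝ) : velocity γ (momentum γ y) = slope γ y := by
  rw [slope, velocity, ← momentum_max γ y, sqrt_one_add_momentum_sq (le_max_right _ _)]

lemma energy_momentum (hy : 0 ≤ y) : energy γ (momentum γ y) = y := by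
  rw [energy, sqrt_one_add_momentum_sq hy, momentum_of_nonneg hy, Real.sq_sqrt (by positivity)]
  have : 0 < 1 + (1 + γ ^ 2 * y) := by positivity
  field_simp
  ring

lemma momentum_energy (hq : 0 ≤ q) : momentum γ (energy γ q) = q := by
  have hu := sqrt_one_add_sq_pos γ q
  have hs : √(1 + γ ^ 2 * q ^ 2) ^ 2 = 1 + γ ^ 2 * q ^ 2 := Real.sq_sqrt (one_add_sq_pos γ q).le
  rw [momentum_of_nonneg (energy_nonneg γ q), energy]
  rw [← Real.sqrt_sq hq]
  congr 1
  rw [Real.sqrt_sq hq]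
  set u := √(1 + γ ^ 2 * q ^ 2)
  field_simp
  linear_combination -q ^ 2 * hs

lemma slope_energy (hq : 0 ≤ q) : slope γ (energy γ q) = velocity γ q := by
  rw [← velocity_momentum, momentum_energy hq]

lemma slope_mono (γ : ℝ) : Monotone (slope γ) := by
  intro a b h
  rw [← velocity_momentum, ← velocity_momentum]
  exact (velocity_strictMono γ).monotone (momentum_mono γ h)

lemma continuous_slope (γ : ℝ) : Continuous (slope γ) := by
  have : slope γ = velocity γ ∘ momentum γ := funext fun y => (velocity_momentum γ y).symm
  rw [this]
  exact (continuous_velocity γ).comp (continuous_momentum γ)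

lemma slope_nonneg (γ y : ℝ) : 0 ≤ slope γ y := by
  rw [← velocity_momentum]; exact velocity_nonneg (momentum_nonneg γ y)

lemma slope_of_nonpos (hy : y ≤ 0) : slope γ y = 0 := by
  simp [slope, momentum, max_eq_right hy]

lemma momentum_pos (hy : 0 < y) : 0 < momentum γ y := by
  rw [momentum_of_nonneg hy.le]
  exact Real.sqrt_pos.2 (by positivity)

lemma slope_pos (hy : 0 < y) : 0 < slope γ y := by
  rw [← velocity_momentum]
  exact velocity_pos_iff.2 (momentum_pos hy)

lemma slope_le_momentum (γ y : ℝ) : slope γ y ≤ momentum γ y := by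
  rw [← velocity_momentum]; exact velocity_le (momentum_nonneg γ y)

lemma momentum_eq_slope_mul (hy : 0 ≤ y) : momentum γ y = slope γ y * (1 + γ ^ 2 * y) := by
  have : 0 < 1 + γ ^ 2 * y := by positivity
  rw [slope, max_eq_left hy]
  field_simp

/-- Inverse function rule for `energy' = velocity`. It fails at `y = 0`, which is why arguments
through the momentum need a positive energy. -/
lemma hasDerivAt_momentum (hy : 0 < y) : HasDerivAt (momentum γ) (1 / slope γ y) y := by
  have h0 : 0 < 2 * y + γ ^ 2 * y ^ 2 := by positivity
  have h := (((hasDerivAt_id y).const_mul 2).add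
    ((hasDerivAt_pow 2 y).const_mul (γ ^ 2))).sqrt h0.ne'
  have h2 := h.congr_of_eventuallyEq (f₁ := momentum γ) (by
    filter_upwards [lt_mem_nhds hy] with x hx
    exact momentum_of_nonneg hx.le)
  refine h2.congr_deriv ?_
  rw [slope, momentum_of_nonneg hy.le, max_eq_left hy.le]
  have := Real.sqrt_pos.2 h0
  simp only [Pi.add_apply, id]
  field_simp
  norm_num
  ring

lemma sqrt_two_mul_div_le_slope (hy : 0 ≤ y) : √(2 * y) / (1 + γ ^ 2 * y) ≤ slope γ y := by
  rw [slope, max_eq_left hy, momentum_of_nonneg hy]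
  gcongr
  nlinarith [mul_nonneg (sq_nonneg γ) (sq_nonneg y)]

lemma slope_le_sqrt (hy : 0 ≤ y) : slope γ y ≤ √(2 * y) := by
  have h1 : 0 < 1 + γ ^ 2 * y := by positivity
  rw [slope, max_eq_left hy, momentum_of_nonneg hy, div_le_iff₀ h1]
  rw [show √(2 * y) * (1 + γ ^ 2 * y) = √(2 * y * (1 + γ ^ 2 * y) ^ 2) by
    rw [Real.sqrt_mul (x := 2 * y) (by positivity), Real.sqrt_sq h1.le]]
  apply Real.sqrt_le_sqrt
  have h3 : 0 ≤ γ ^ 2 * y ^ 2 := by positivity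
  have h4 : 0 ≤ γ ^ 4 * y ^ 3 := by positivity
  nlinarith

lemma slope_zero_eq (hy : 0 ≤ y) : slope 0 y = √(2 * y) := by
  simp [slope, momentum, max_eq_left hy]

/-- `slope γ` tends to `slope 0` locally uniformly as `γ → 0`. -/
lemma abs_slope_sub_slope_zero_le {M : ℝ} (hM : 0 ≤ M) (hy : y ≤ M) :
    |slope γ y - slope 0 y| ≤ √(2 * M) * M * γ ^ 2 := by
  rcases le_or_gt y 0 with h | h
  · rw [slope_of_nonpos h, slope_of_nonpos h]; simp; positivity
  · have h1 := slope_le_sqrt (γ := γ) h.le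
    have h2 := sqrt_two_mul_div_le_slope (γ := γ) h.le
    rw [slope_zero_eq h.le, abs_sub_comm, abs_of_nonneg (by linarith)]
    have h3 : √(2 * y) - √(2 * y) / (1 + γ ^ 2 * y) ≤ √(2 * y) * y * γ ^ 2 := by
      have h1 : 0 < 1 + γ ^ 2 * y := by positivity
      rw [sub_le_iff_le_add, ← sub_le_iff_le_add', le_div_iff₀ h1]
      have : 0 ≤ √(2 * y) * (γ ^ 2 * y) ^ 2 := by positivity
      nlinarith
    have h4 : √(2 * y) * y * γ ^ 2 ≤ √(2 * M) * M * γ ^ 2 := by gcongr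
    linarith

/-- From `√(1 + γ²q²) ≤ 1 + γq`. The bound is explicit and stays positive in limits of both `γ` and
`q > 0`. -/
lemma div_two_add_le_energy (hγ : 0 ≤ γ) (hq : 0 ≤ q) : q ^ 2 / (2 + γ * q) ≤ energy γ q := by
  rw [energy]
  have h : √(1 + γ ^ 2 * q ^ 2) ≤ 1 + γ * q := by
    rw [Real.sqrt_le_left (by positivity)]
    nlinarith [mul_nonneg hγ hq]
  exact div_le_div_of_nonneg_left (sq_nonneg q) (by positivity) (by linarith)

lemma le_of_le_momentum (hq : 0 < q) (h : q ≤ momentum γ y) : energy γ q ≤ y := by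
  have hy : 0 < y := by
    by_contra! hy
    have : momentum γ y = 0 := by simp [momentum, max_eq_right hy]
    linarith
  by_contra! hlt
  have h1 := momentum_energy (γ := γ) hq.le
  have hE : MonotoneOn (energy γ) (Ici 0) := by
    apply monotoneOn_of_deriv_nonneg (convex_Ici 0) (continuous_energy γ).continuousOn
    · exact fun x _ => (hasDerivAt_energy γ x).differentiableAt.differentiableWithinAt
    · intro x hx
      rw [(hasDerivAt_energy γ x).deriv]
      rw [interior_Ici] at hx
      exact velocity_nonneg (le_of_lt hx)
  have := hE hq.le (momentum_nonneg γ y) h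
  rw [energy_momentum hy.le] at this
  linarith

end BornInfeld

/-! ### Comparison and existence for terminal value problems with monotone nonlinearity. -/

namespace BornInfeld

/-- The squared positive part is `C¹`, so sign conditions imposed only where `D > 0` yield
monotonicity without cutting the interval at the zeros of `D`. -/
lemma hasDerivAt_max_zero_sq (x : ℝ) : HasDerivAt (fun x : ℝ => max x 0 ^ 2) (2 * max x 0) x := by
  rcases lt_trichotomy x 0 with h | h | h
  · rw [max_eq_right h.le, mul_zero]
    refine (hasDerivAt_const x (0 : ℝ)).congr_of_eventuallyEq ?_
    filter_upwards [gt_mem_nhds h] with t ht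
    rw [max_eq_right (le_of_lt ht)]; norm_num
  · subst h
    rw [max_self, mul_zero, hasDerivAt_iff_isLittleO_nhds_zero]
    simp only [zero_add, max_self, smul_zero, sub_zero]
    have h1 : (fun x : ℝ => max x 0 ^ 2 - 0 ^ 2) =O[𝓝 0] fun x : ℝ => x ^ 2 := by
      apply Asymptotics.isBigO_of_le
      intro x
      rcases le_total x 0 with hx | hx
      · rw [max_eq_right hx]; simpa using sq_nonneg x
      · rw [max_eq_left hx]; simp
    refine h1.trans_isLittleO ?_
    simpa using (Asymptotics.isLittleO_pow_pow (𝕜 := ℝ) (m := 1) (n := 2) (by norm_num))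
  · rw [max_eq_left h.le]
    have := hasDerivAt_pow 2 x
    norm_num at this
    refine this.congr_of_eventuallyEq ?_
    filter_upwards [lt_mem_nhds h] with t ht
    rw [max_eq_left (le_of_lt ht)]

variable {a b : ℝ} {D D' : ℝ → ℝ}

/-- A function which is nondecreasing where it is positive, and nonpositive at the right end, is
nonpositive. -/
lemma nonpos_of_deriv_nonneg_of_pos (hc : ContinuousOn D (Icc a b))
    (hd : ∀ s ∈ Ioo a b, HasDerivAt D (D' s) s) (h : ∀ s ∈ Ioo a b, 0 < D s → 0 ≤ D' s)
    (hb : D b ≤ 0) : ∀ s ∈ Icc a b, D s ≤ 0 := by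
  intro s hs
  have hm : MonotoneOn (fun s => max (D s) 0 ^ 2) (Icc a b) := by
    apply monotoneOn_of_hasDerivWithinAt_nonneg (convex_Icc a b)
      (f' := fun s => 2 * max (D s) 0 * D' s)
    · exact (hc.sup continuousOn_const).pow 2
    · intro x hx
      rw [interior_Icc] at hx
      exact ((hasDerivAt_max_zero_sq (D x)).comp x (hd x hx)).hasDerivWithinAt
    · intro x hx
      rw [interior_Icc] at hx
      rcases le_or_gt (D x) 0 with h0 | h0
      · simp [max_eq_right h0]
      · have := h x hx h0
        rw [max_eq_left h0.le]; positivity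
  have h1 := hm hs (right_mem_Icc.2 (hs.1.trans hs.2)) hs.2
  simp only [max_eq_right hb] at h1
  have h2 : max (D s) 0 = 0 := by nlinarith [sq_nonneg (max (D s) 0)]
  exact max_eq_right_iff.1 h2

/-- A function which is nonincreasing where it is positive, and nonpositive at the left end, is
nonpositive. -/
lemma nonpos_of_deriv_nonpos_of_pos (hc : ContinuousOn D (Icc a b))
    (hd : ∀ s ∈ Ioo a b, HasDerivAt D (D' s) s) (h : ∀ s ∈ Ioo a b, 0 < D s → D' s ≤ 0)
    (ha : D a ≤ 0) : ∀ s ∈ Icc a b, D s ≤ 0 := by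
  intro s hs
  have := nonpos_of_deriv_nonneg_of_pos (a := -b) (b := -a) (D := fun s => D (-s))
    (D' := fun s => -D' (-s))
    (hc.comp continuous_neg.continuousOn fun x hx => ⟨by linarith [hx.2], by linarith [hx.1]⟩)
    (fun x hx => ((hd (-x) ⟨by linarith [hx.2], by linarith [hx.1]⟩).comp x
      (hasDerivAt_neg x)).congr_deriv (mul_neg_one _))
    (fun x hx h0 => by
      have := h (-x) ⟨by linarith [hx.2], by linarith [hx.1]⟩ h0
      linarith) (by simpa using ha) (-s) ⟨by linarith [hs.2], by linarith [hs.1]⟩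
  simpa using this

/-- `y` solves `y' = h(y) - f` on `[0, 1]` and vanishes at `1`. -/
structure IsTerminalSolution (h f y : ℝ → ℝ) : Prop where
  map_one : y 1 = 0
  hasDerivAt : ∀ s ∈ Icc (0 : ℝ) 1, HasDerivAt y (h (y s) - f s) s

namespace IsTerminalSolution

variable {h h₁ h₂ f y y₁ y₂ : ℝ → ℝ}

lemma continuousOn (hy : IsTerminalSolution h f y) : ContinuousOn y (Icc 0 1) :=
  fun s hs => (hy.hasDerivAt s hs).continuousAt.continuousWithinAt

/-- Where `y₁` exceeds `y₂ + ε(1 - s)`, monotonicity of `h₁` makes the excess nondecreasing; since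
it vanishes at `1`, it is never positive. No Lipschitz bound is involved, so the square root is
allowed. -/
lemma le_add (H₁ : IsTerminalSolution h₁ f y₁) (H₂ : IsTerminalSolution h₂ f y₂)
    (hm : Monotone h₁) {ε : ℝ} (hε : 0 ≤ ε)
    (hle : ∀ s ∈ Icc (0 : ℝ) 1, h₂ (y₂ s) ≤ h₁ (y₂ s) + ε) :
    ∀ s ∈ Icc (0 : ℝ) 1, y₁ s ≤ y₂ s + ε * (1 - s) := by
  intro s hs
  have := nonpos_of_deriv_nonneg_of_pos (a := 0) (b := 1)
    (D := fun s => y₁ s - y₂ s - ε * (1 - s))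
    (D' := fun s => (h₁ (y₁ s) - f s) - (h₂ (y₂ s) - f s) - ε * (-1))
    ((H₁.continuousOn.sub H₂.continuousOn).sub (by fun_prop))
    (fun s hs => ((H₁.hasDerivAt s (Ioo_subset_Icc_self hs)).sub
      (H₂.hasDerivAt s (Ioo_subset_Icc_self hs))).sub
        (((hasDerivAt_id s).const_sub 1).const_mul ε))
    (fun s hs h0 => by
      have h1 : y₂ s ≤ y₁ s := by nlinarith [hs.2]
      have h2 := hm h1
      have h3 := hle s (Ioo_subset_Icc_self hs)
      linarith) (by simp [H₁.map_one, H₂.map_one]) s hs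
  linarith

/-- The nonlinearities need only be close along `y₂`, so an a priori bound on one solution is
enough. -/
lemma abs_sub_le (H₁ : IsTerminalSolution h₁ f y₁) (H₂ : IsTerminalSolution h₂ f y₂)
    (hm : Monotone h₁) {ε : ℝ} (hε : 0 ≤ ε)
    (hle : ∀ s ∈ Icc (0 : ℝ) 1, |h₁ (y₂ s) - h₂ (y₂ s)| ≤ ε) :
    ∀ s ∈ Icc (0 : ℝ) 1, |y₁ s - y₂ s| ≤ ε := by
  intro s hs
  have h1 := le_add H₁ H₂ hm hε (fun s hs => by linarith [neg_le_of_abs_le (hle s hs)]) s hs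
  have h2 := nonpos_of_deriv_nonneg_of_pos (a := 0) (b := 1)
    (D := fun s => y₂ s - y₁ s - ε * (1 - s))
    (D' := fun s => (h₂ (y₂ s) - f s) - (h₁ (y₁ s) - f s) - ε * (-1))
    ((H₂.continuousOn.sub H₁.continuousOn).sub (by fun_prop))
    (fun s hs => ((H₂.hasDerivAt s (Ioo_subset_Icc_self hs)).sub
      (H₁.hasDerivAt s (Ioo_subset_Icc_self hs))).sub
        (((hasDerivAt_id s).const_sub 1).const_mul ε))
    (fun s hs h0 => by
      have h1 : y₁ s ≤ y₂ s := by nlinarith [hs.2]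
      have h2 := hm h1
      have h3 := le_of_abs_le (hle s (Ioo_subset_Icc_self hs))
      linarith) (by simp [H₁.map_one, H₂.map_one]) s hs
  have h3 : ε * (1 - s) ≤ ε := by nlinarith [hs.1]
  exact abs_le.2 ⟨by linarith, by linarith⟩

lemma integral_eq (H : IsTerminalSolution h f y) (hh : Continuous h) (hf : Continuous f)
    {s : ℝ} (hs : s ∈ Icc (0 : ℝ) 1) : y s = ∫ t in s..1, (f t - h (y t)) := by
  have hsub : uIcc s 1 ⊆ Icc 0 1 := by
    rw [uIcc_of_le hs.2]; exact Icc_subset_Icc_left hs.1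
  have h1 := intervalIntegral.integral_eq_sub_of_hasDerivAt (a := s) (b := 1)
    (fun t ht => H.hasDerivAt t (hsub ht))
    (((hh.comp_continuousOn (H.continuousOn.mono hsub)).sub
      hf.continuousOn).intervalIntegrable)
  rw [H.map_one] at h1
  have h2 : (∫ t in s..1, (f t - h (y t))) = -∫ t in s..1, (h (y t) - f t) := by
    rw [← intervalIntegral.integral_neg]; simp
  rw [h2, h1]; ring

lemma of_integral_eq (hh : Continuous h) (hf : Continuous f) (hy : ContinuousOn y (Icc 0 1))
    (hint : ∀ s ∈ Icc (0 : ℝ) 1, y s = ∫ t in s..1, (f t - h (y t))) :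
    ∃ y₀, IsTerminalSolution h f y₀ := by
  -- Continuing `y` by constants outside `[0, 1]` makes its primitive differentiable from both sides
  -- at `0` and `1`.
  have hext : Continuous (IccExtend zero_le_one ((Icc (0 : ℝ) 1).domRestrict y)) :=
    hy.domRestrict.Icc_extend'
  set z := IccExtend zero_le_one ((Icc (0 : ℝ) 1).domRestrict y)
  have hz : ∀ s ∈ Icc (0 : ℝ) 1, z s = y s := fun s hs => by
    simp [z, IccExtend_of_mem _ _ hs, Set.domRestrict]
  have hcont : Continuous fun t => h (z t) - f t := (hh.comp hext).sub hf
  have heq : ∀ s ∈ Icc (0 : ℝ) 1, ∫ t in (1 : ℝ)..s, (h (z t) - f t) = y s := by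
    intro s hs
    rw [intervalIntegral.integral_symm, ← intervalIntegral.integral_neg, hint s hs]
    apply intervalIntegral.integral_congr
    intro t ht
    rw [uIcc_of_le hs.2] at ht
    simp [hz t ⟨hs.1.trans ht.1, ht.2⟩]
  refine ⟨fun s => ∫ t in (1 : ℝ)..s, (h (z t) - f t), by simp, fun s hs => ?_⟩
  have := intervalIntegral.integral_hasDerivAt_right (hcont.intervalIntegrable 1 s)
    (hcont.stronglyMeasurableAtFilter _ _) hcont.continuousAt
  rwa [heq s hs, ← hz s hs]

/-- Global existence for a bounded Lipschitz nonlinearity. -/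
lemma exists_of_lipschitz (hf : Continuous f) {K : NNReal} (hK : LipschitzWith K h) {B : ℝ}
    (hB : ∀ x, |h x| ≤ B) : ∃ y, IsTerminalSolution h f y := by
  obtain ⟨C, hC⟩ := isCompact_Icc.exists_bound_of_continuousOn (hf.continuousOn (s := Icc (-1) 2))
  have hB0 : 0 ≤ B := (abs_nonneg _).trans (hB 0)
  have hC0 : 0 ≤ C := (norm_nonneg _).trans (hC 0 (by norm_num))
  -- The larger interval `[-1, 2]` gives two-sided derivatives at `0` and `1`. From time `1` the
  -- farthest end is at distance `2`, so at rate at most `B + C` the solution stays in the ball of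
  -- radius `2(B + C)`.
  have hPL : IsPicardLindelof (fun t x => h x - f t) (tmin := -1) (tmax := 2)
      ⟨1, by norm_num⟩ 0 ⟨2 * (B + C), by positivity⟩ 0 ⟨B + C, by positivity⟩ K := by
    refine ⟨fun t _ => ?_, fun x _ => ?_, fun t ht x _ => ?_, ?_⟩
    · refine (LipschitzWith.of_dist_le_mul fun x z => ?_).lipschitzOnWith
      simpa using hK.dist_le_mul x z
    · exact (continuous_const.sub hf).continuousOn
    · exact (norm_sub_le _ _).trans (add_le_add (hB x) (hC t ht))
    · norm_num
      change (B + C) * 2 ≤ 2 * (B + C)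
      linarith
  obtain ⟨y, hy1, hy⟩ := hPL.exists_eq_forall_mem_Icc_hasDerivWithinAt₀
  exact ⟨y, hy1, fun s hs => (hy s ⟨by linarith [hs.1], by linarith [hs.2]⟩).hasDerivAt
    (Icc_mem_nhds (by linarith [hs.1]) (by linarith [hs.2]))⟩

/-- Existence passes to uniform limits of monotone nonlinearities. -/
lemma exists_of_approx (hf : Continuous f) (hh : Continuous h) {hn : ℕ → ℝ → ℝ}
    (hcont : ∀ n, Continuous (hn n)) (hmono : ∀ n, Monotone (hn n)) {B : ℝ}
    (hB : ∀ n x, |hn n x| ≤ B) {ε : ℕ → ℝ} (hε : Tendsto ε atTop (𝓝 0))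
    (happ : ∀ n x, |hn n x - h x| ≤ ε n) (hex : ∀ n, ∃ y, IsTerminalSolution (hn n) f y) :
    ∃ y, IsTerminalSolution h f y := by
  choose y hy using hex
  have hε0 : ∀ n, 0 ≤ ε n := fun n => (abs_nonneg _).trans (happ n 0)
  -- Comparison makes the approximations Cauchy, so the whole sequence converges without extracting
  -- subsequences.
  have hd : ∀ n m, ∀ s ∈ Icc (0 : ℝ) 1, |y n s - y m s| ≤ ε n + ε m := fun n m =>
    abs_sub_le (hy n) (hy m) (hmono n) (add_nonneg (hε0 n) (hε0 m)) fun s _ => by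
      have h1 := happ n (y m s)
      have h2 := happ m (y m s)
      rw [abs_le] at *
      constructor <;> linarith [h1.1, h1.2, h2.1, h2.2]
  have hC : UniformCauchySeqOn y atTop (Icc (0 : ℝ) 1) := by
    rw [Metric.uniformCauchySeqOn_iff]
    intro δ hδ
    obtain ⟨N, hN⟩ := eventually_atTop.1 (hε.eventually_lt_const (half_pos hδ))
    refine ⟨N, fun m hm n hn s hs => ?_⟩
    rw [Real.dist_eq]
    linarith [hd m n s hs, hN m hm, hN n hn]
  have hlim : ∀ s, ∃ l, s ∈ Icc (0 : ℝ) 1 → Tendsto (fun n => y n s) atTop (𝓝 l) := by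
    intro s
    by_cases hs : s ∈ Icc (0 : ℝ) 1
    · obtain ⟨l, hl⟩ := cauchySeq_tendsto_of_complete (hC.cauchySeq hs)
      exact ⟨l, fun _ => hl⟩
    · exact ⟨0, fun h => absurd h hs⟩
  choose Y hY using hlim
  have hU : TendstoUniformlyOn y Y atTop (Icc (0 : ℝ) 1) :=
    hC.tendstoUniformlyOn_of_tendsto fun s hs => hY s hs
  have hYc : ContinuousOn Y (Icc 0 1) :=
    hU.continuousOn (Frequently.of_forall fun n => (hy n).continuousOn)
  apply of_integral_eq hh hf hYc
  intro s hs
  refine tendsto_nhds_unique (hY s hs) ?_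
  simp_rw [fun n => (hy n).integral_eq (hcont n) hf hs]
  obtain ⟨C, hC⟩ := isCompact_Icc.exists_bound_of_continuousOn (hf.continuousOn (s := Icc 0 1))
  have hmem : ∀ t ∈ uIoc s 1, t ∈ Icc (0 : ℝ) 1 := fun t ht => by
    rw [uIoc_of_le hs.2] at ht
    exact ⟨hs.1.trans ht.1.le, ht.2⟩
  have hsub : uIoc s 1 ⊆ Icc 0 1 := hmem
  apply intervalIntegral.tendsto_integral_filter_of_dominated_convergence (fun _ => C + B)
  · refine Eventually.of_forall fun n => ?_
    exact ((hf.continuousOn.sub ((hcont n).comp_continuousOn (hy n).continuousOn)).mono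
      hsub).aestronglyMeasurable measurableSet_uIoc
  · refine Eventually.of_forall fun n => Eventually.of_forall fun t ht => ?_
    exact (norm_sub_le _ _).trans (add_le_add (hC t (hmem t ht)) (hB n _))
  · exact intervalIntegrable_const
  · refine Eventually.of_forall fun t ht => tendsto_const_nhds.sub ?_
    have h1 : Tendsto (fun n => h (y n t)) atTop (𝓝 (h (Y t))) :=
      (hh.tendsto _).comp (hY t (hmem t ht))
    have h2 : Tendsto (fun n => hn n (y n t) - h (y n t)) atTop (𝓝 0) :=
      squeeze_zero_norm (fun n => happ n _) hε
    simpa using h2.add h1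

end IsTerminalSolution

end BornInfeld

/-! ### The energy as a function of the value of the profile. -/

namespace BornInfeld

/-- The common features of the reaction terms of types A (with `α = 0`), B and C, for a
continuous function on the line. -/
structure IsSignedReaction (f : ℝ → ℝ) (α k : ℝ) : Prop where
  continuous : Continuous f
  mem_Ico : α ∈ Ico (0 : ℝ) 1
  nonpos : ∀ s ∈ Icc 0 α, f s ≤ 0
  pos : ∀ s ∈ Ioo α 1, 0 < f s
  integral_nonneg : 0 ≤ ∫ s in (0 : ℝ)..1, f s
  integral_pos : ∀ s ∈ Ioo (0 : ℝ) 1, 0 < ∫ t in s..1, f t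
  k_pos : 0 < k
  abs_le_left : ∀ s ∈ Icc (0 : ℝ) 1, |f s| ≤ k * s
  abs_le_right : ∀ s ∈ Icc (0 : ℝ) 1, |f s| ≤ k * (1 - s)

/-- The energy `y` of a front of speed `c` as a function of its value solves
`y' = c * slope γ y - f` and vanishes at `1`. -/
abbrev IsEnergy (γ c : ℝ) (f y : ℝ → ℝ) : Prop :=
  IsTerminalSolution (fun y => c * slope γ y) f y

/-- A function solving the energy equation, if there is one. -/
noncomputable def energyProfile (γ c : ℝ) (f : ℝ → ℝ) : ℝ → ℝ :=
  Classical.epsilon (IsEnergy γ c f)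

/-- By the chain rule the derivative of the slope is at most `1 / slope γ y`, and the slope
increases with `y`; the only singular point is `0`. -/
lemma lipschitzOnWith_slope {γ ε : ℝ} (hε : 0 < ε) :
    LipschitzOnWith (1 / slope γ ε).toNNReal (slope γ) (Ici ε) := by
  have h : slope γ = velocity γ ∘ momentum γ := funext fun y => (velocity_momentum γ y).symm
  apply Convex.lipschitzOnWith_of_nnnorm_hasDerivWithin_le (convex_Ici ε)
    (f' := fun y => 1 / √(1 + γ ^ 2 * momentum γ y ^ 2) ^ 3 * (1 / slope γ y))
  · intro y hy
    have := ((hasDerivAt_velocity γ (momentum γ y)).comp y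
      (hasDerivAt_momentum (hε.trans_le hy))).hasDerivWithinAt (s := Ici ε)
    rwa [← h] at this
  · intro y hy
    have h1 : 0 < slope γ ε := slope_pos hε
    have h2 : slope γ ε ≤ slope γ y := slope_mono γ hy
    have h3 := one_le_pow₀ (n := 3) (one_le_sqrt_one_add_sq γ (momentum γ y))
    have h4 : 0 < slope γ y := h1.trans_le h2
    rw [← NNReal.coe_le_coe, coe_nnnorm, Real.norm_eq_abs, abs_of_nonneg (by positivity),
      Real.coe_toNNReal _ (by positivity)]
    calc _ ≤ 1 * (1 / slope γ ε) := by
          gcongr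
          exact (div_le_one (by positivity)).2 h3
      _ = _ := one_mul _

lemma monotone_const_mul_slope {γ c : ℝ} (hc : 0 ≤ c) : Monotone fun y => c * slope γ y :=
  fun _ _ h => mul_le_mul_of_nonneg_left (slope_mono γ h) hc

lemma continuous_const_mul_slope (γ c : ℝ) : Continuous fun y => c * slope γ y :=
  (continuous_slope γ).const_mul c

namespace IsSignedReaction

variable {f : ℝ → ℝ} {α k γ c : ℝ}

/-- The cut at `k` makes the nonlinearity bounded. The cut at `1/(n+1)` keeps away from the corner
at `0`, costs at most `c * slope γ (1/(n+1))`, and is removed by `exists_of_approx`. -/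
lemma exists_clipped (hf : IsSignedReaction f α k) (hc : 0 ≤ c) :
    ∃ y, IsTerminalSolution (fun y => c * slope γ (min y k)) f y := by
  have hε0 : ∀ n : ℕ, (0 : ℝ) < 1 / (n + 1) := fun n => by positivity
  have hε1 : ∀ n : ℕ, (1 : ℝ) / (n + 1) ≤ 1 := fun n => by
    rw [div_le_one (by positivity)]; linarith [n.cast_nonneg (α := ℝ)]
  have hlip : ∀ n : ℕ, LipschitzWith 1 fun y : ℝ => max (min y k) (1 / (n + 1)) := fun n =>
    (LipschitzWith.id.min_const k).max_const _
  have hcl : Continuous fun y => c * slope γ (min y k) :=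
    (continuous_const_mul_slope γ c).comp (by fun_prop)
  apply IsTerminalSolution.exists_of_approx hf.continuous hcl
    (hn := fun n y => c * slope γ (max (min y k) (1 / (n + 1))))
    (B := c * slope γ (max k 1)) (ε := fun n => c * slope γ (1 / (n + 1)))
  · exact fun n => (continuous_const_mul_slope γ c).comp (hlip n).continuous
  · exact fun n => (monotone_const_mul_slope hc).comp fun a b h => by gcongr
  · intro n x
    rw [abs_of_nonneg (mul_nonneg hc (slope_nonneg _ _))]
    exact monotone_const_mul_slope hc (max_le_max (min_le_right _ _) (hε1 n))
  · have h1 := (continuous_const_mul_slope γ c).tendsto 0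
    rw [slope_of_nonpos le_rfl, mul_zero] at h1
    exact h1.comp tendsto_one_div_add_atTop_nhds_zero_nat
  · intro n x
    rw [← mul_sub, abs_mul, abs_of_nonneg hc]
    refine mul_le_mul_of_nonneg_left ?_ hc
    rcases le_total (min x k) (1 / (n + 1)) with h | h
    · rw [max_eq_right h, abs_of_nonneg (sub_nonneg.2 (slope_mono γ h))]
      linarith [slope_nonneg γ (min x k)]
    · rw [max_eq_left h, sub_self, abs_zero]
      exact slope_nonneg _ _
  · intro n
    have hK : LipschitzWith
        (c.toNNReal * ((1 / slope γ (1 / (n + 1))).toNNReal * 1))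
        fun y => c * slope γ (max (min y k) (1 / (n + 1))) := by
      have h1 := (lipschitzOnWith_slope (γ := γ) (hε0 n)).comp (hlip n).lipschitzOnWith
        (s := univ) (fun y _ => mem_Ici.2 (le_max_right _ _))
      rw [lipschitzOnWith_univ] at h1
      refine LipschitzWith.of_dist_le_mul fun x y => ?_
      have h2 := h1.dist_le_mul x y
      rw [Real.dist_eq] at h2
      rw [Real.dist_eq, ← mul_sub, abs_mul, abs_of_nonneg hc, NNReal.coe_mul, mul_assoc,
        Real.coe_toNNReal c hc]
      exact mul_le_mul_of_nonneg_left h2 hc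
    refine IsTerminalSolution.exists_of_lipschitz hf.continuous hK
      (B := c * slope γ (max k 1)) fun x => ?_
    rw [abs_of_nonneg (mul_nonneg hc (slope_nonneg _ _))]
    exact monotone_const_mul_slope hc (max_le_max (min_le_right _ _) (hε1 n))

/-- Integrate `y' ≥ -f ≥ -k(1 - s)` back from `1`. Besides showing that the cut at `k` is harmless,
the quadratic decay at `1` makes the slope at most linear there. -/
lemma terminalSolution_le (hf : IsSignedReaction f α k) {h y : ℝ → ℝ} (hh : ∀ x, 0 ≤ h x)
    (hy : IsTerminalSolution h f y) : ∀ s ∈ Icc (0 : ℝ) 1, y s ≤ k * (1 - s) ^ 2 / 2 := by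
  intro s hs
  have := nonpos_of_deriv_nonneg_of_pos (a := 0) (b := 1)
    (D := fun s => y s - k * (1 - s) ^ 2 / 2)
    (D' := fun s => h (y s) - f s - k * (2 * (1 - s) * (-1)) / 2)
    (hy.continuousOn.sub (by fun_prop))
    (fun s hs => (hy.hasDerivAt s (Ioo_subset_Icc_self hs)).sub (by
      have := ((((hasDerivAt_id s).const_sub 1).pow 2).const_mul k).div_const 2
      simpa using this))
    (fun s hs _ => by
      have h1 := le_of_abs_le (hf.abs_le_right s (Ioo_subset_Icc_self hs))
      have h2 := hh (y s)
      linarith) (by simp [hy.map_one]) s hs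
  linarith

lemma exists_energy (hf : IsSignedReaction f α k) (hc : 0 ≤ c) : ∃ y, IsEnergy γ c f y := by
  obtain ⟨y, hy⟩ := hf.exists_clipped (γ := γ) hc
  refine ⟨y, hy.map_one, fun s hs => ?_⟩
  have h1 := hf.terminalSolution_le (fun x => mul_nonneg hc (slope_nonneg _ _)) hy s hs
  have h2 : y s ≤ k := by nlinarith [hs.1, hs.2, hf.k_pos, mul_nonneg hs.1 (sub_nonneg.2 hs.2)]
  have := hy.hasDerivAt s hs
  rwa [min_eq_left h2] at this

lemma isEnergy (hf : IsSignedReaction f α k) (hc : 0 ≤ c) :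
    IsEnergy γ c f (energyProfile γ c f) :=
  Classical.epsilon_spec (hf.exists_energy hc)

lemma energyProfile_le (hf : IsSignedReaction f α k) (hc : 0 ≤ c) :
    ∀ s ∈ Icc (0 : ℝ) 1, energyProfile γ c f s ≤ k * (1 - s) ^ 2 / 2 :=
  hf.terminalSolution_le (fun _ => mul_nonneg hc (slope_nonneg _ _)) (hf.isEnergy hc)

lemma energyProfile_le_k (hf : IsSignedReaction f α k) (hc : 0 ≤ c) :
    ∀ s ∈ Icc (0 : ℝ) 1, energyProfile γ c f s ≤ k := by
  intro s hs
  have h1 := hf.energyProfile_le (γ := γ) hc s hs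
  nlinarith [hs.1, hs.2, hf.k_pos, mul_nonneg hs.1 (sub_nonneg.2 hs.2)]

lemma energyProfile_one (hf : IsSignedReaction f α k) (hc : 0 ≤ c) :
    energyProfile γ c f 1 = 0 := (hf.isEnergy hc).map_one

lemma continuousOn_energyProfile (hf : IsSignedReaction f α k) (hc : 0 ≤ c) :
    ContinuousOn (energyProfile γ c f) (Icc 0 1) := (hf.isEnergy hc).continuousOn

lemma hasDerivAt_energyProfile (hf : IsSignedReaction f α k) (hc : 0 ≤ c) {s : ℝ}
    (hs : s ∈ Icc (0 : ℝ) 1) : HasDerivAt (energyProfile γ c f)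
      (c * slope γ (energyProfile γ c f s) - f s) s := (hf.isEnergy hc).hasDerivAt s hs

lemma energyProfile_speed_zero (hf : IsSignedReaction f α k) {s : ℝ}
    (hs : s ∈ Icc (0 : ℝ) 1) : energyProfile γ 0 f s = ∫ t in s..1, f t := by
  have := (hf.isEnergy (γ := γ) le_rfl).integral_eq (continuous_const_mul_slope γ 0)
    hf.continuous hs
  simpa using this

/-- Where `y < 0` the slope vanishes and `y' = -f < 0`, incompatible with `y 1 = 0`. An interior
zero would be a local minimum, yet its derivative is `-f < 0`. -/
lemma energyProfile_pos_right (hf : IsSignedReaction f α k) (hc : 0 ≤ c) :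
    ∀ s ∈ Ioo α 1, 0 < energyProfile γ c f s := by
  have hsub : Icc α 1 ⊆ Icc 0 1 := Icc_subset_Icc_left hf.mem_Ico.1
  have hnn : ∀ s ∈ Icc α 1, 0 ≤ energyProfile γ c f s := by
    intro s hs
    have := nonpos_of_deriv_nonneg_of_pos (D := fun s => -energyProfile γ c f s)
      ((hf.continuousOn_energyProfile (γ := γ) hc).mono hsub).neg
      (fun s hs => (hf.hasDerivAt_energyProfile hc (hsub (Ioo_subset_Icc_self hs))).neg)
      (fun s hs h0 => by
        have := hf.pos s hs
        rw [slope_of_nonpos (by linarith)]; linarith)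
      (by simp [hf.energyProfile_one hc]) s hs
    linarith
  intro s hs
  refine (hnn s (Ioo_subset_Icc_self hs)).lt_of_ne fun h0 => ?_
  have hmin : IsLocalMin (energyProfile γ c f) s := by
    filter_upwards [Icc_mem_nhds hs.1 hs.2] with t ht
    rw [← h0]; exact hnn t ht
  have h1 := hmin.hasDerivAt_eq_zero
    (hf.hasDerivAt_energyProfile hc (hsub (Ioo_subset_Icc_self hs)))
  rw [← h0, slope_of_nonpos le_rfl] at h1
  linarith [hf.pos s hs]

/-- The energy is nonincreasing in the speed. -/
lemma energyProfile_anti (hf : IsSignedReaction f α k) (hc : 0 ≤ c) {c' : ℝ} (hcc : c ≤ c') :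
    ∀ s ∈ Icc (0 : ℝ) 1, energyProfile γ c' f s ≤ energyProfile γ c f s := by
  intro s hs
  have := (hf.isEnergy (γ := γ) (hc.trans hcc)).le_add (hf.isEnergy hc)
    (monotone_const_mul_slope (hc.trans hcc)) le_rfl (fun s _ => by
      have := mul_le_mul_of_nonneg_right hcc (slope_nonneg γ (energyProfile γ c f s))
      simpa using this) s hs
  simpa using this

/-- The energy is controlled by `A s²` for large speeds. -/
lemma energyProfile_le_sq (hf : IsSignedReaction f α k) (hc : 0 ≤ c) {A m : ℝ} (hA : 0 < A)
    (hm : ∀ s ∈ Icc (0 : ℝ) 1, f s ≤ m * s)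
    (hcA : (2 * A + m) * (1 + γ ^ 2 * A) ≤ c * √(2 * A)) :
    ∀ s ∈ Icc (0 : ℝ) 1, energyProfile γ c f s ≤ A * s ^ 2 := by
  intro s hs
  -- `A s²` is a supersolution: `c * slope γ (A s²) ≥ c √(2A) s / (1 + γ²A) ≥ (2A + m) s ≥ 2As + f
  -- s`, the middle inequality being the hypothesis on `c`.
  have := nonpos_of_deriv_nonneg_of_pos (a := 0) (b := 1)
    (D := fun s => energyProfile γ c f s - A * s ^ 2)
    (D' := fun s => c * slope γ (energyProfile γ c f s) - f s - A * (2 * s))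
    ((hf.continuousOn_energyProfile hc).sub (by fun_prop))
    (fun s hs => (hf.hasDerivAt_energyProfile hc (Ioo_subset_Icc_self hs)).sub (by
      simpa using (hasDerivAt_pow 2 s).const_mul A))
    (fun s hs h0 => by
      have hs0 := hs.1
      have h1 := slope_mono γ (sub_nonneg.1 h0.le)
      have h2 := sqrt_two_mul_div_le_slope (γ := γ) (y := A * s ^ 2) (by positivity)
      have h3 := hm s (Ioo_subset_Icc_self hs)
      have h4 : √(2 * (A * s ^ 2)) = √(2 * A) * s := by
        rw [← mul_assoc, Real.sqrt_mul (x := 2 * A) (by positivity), Real.sqrt_sq hs0.le]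
      rw [h4] at h2
      have h5 : √(2 * A) * s / (1 + γ ^ 2 * A) ≤ √(2 * A) * s / (1 + γ ^ 2 * (A * s ^ 2)) := by
        have : A * s ^ 2 ≤ A := mul_le_of_le_one_right hA.le (pow_le_one₀ hs0.le hs.2.le)
        gcongr
      have h6 : (2 * A + m) * s ≤ c * (√(2 * A) * s / (1 + γ ^ 2 * A)) := by
        rw [← mul_div_assoc, le_div_iff₀ (by positivity)]
        nlinarith
      have h7 := mul_le_mul_of_nonneg_left (h5.trans (h2.trans h1)) hc
      linarith) (by simp [hf.energyProfile_one hc, hA.le]) s hs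
  linarith

/-- On `[0, α]` both `c * slope` and `-f` are nonnegative, so the energy grows from its value at
`0`. -/
lemma energyProfile_pos_of_zero_pos (hf : IsSignedReaction f α k) (hc : 0 ≤ c)
    (h0 : 0 < energyProfile γ c f 0) : ∀ s ∈ Ico (0 : ℝ) 1, 0 < energyProfile γ c f s := by
  intro s hs
  rcases le_or_gt s α with hsα | hsα
  · have hm : MonotoneOn (energyProfile γ c f) (Icc 0 α) := by
      have hsub : Icc 0 α ⊆ Icc 0 1 := Icc_subset_Icc_right hf.mem_Ico.2.le
      apply monotoneOn_of_hasDerivWithinAt_nonneg (convex_Icc 0 α)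
        ((hf.continuousOn_energyProfile hc).mono hsub)
      · intro x hx
        exact (hf.hasDerivAt_energyProfile hc (hsub (interior_subset hx))).hasDerivWithinAt
      · intro x hx
        have := hf.nonpos x (interior_subset hx)
        have := mul_nonneg hc (slope_nonneg γ (energyProfile γ c f x))
        linarith
    exact h0.trans_le (hm ⟨le_rfl, hs.1.trans hsα⟩ ⟨hs.1, hsα⟩ hs.1)
  · exact hf.energyProfile_pos_right hc s ⟨hsα, hs.2⟩

/-- In the momentum variable the speed enters as an additive term. This makes different speeds
directly comparable near `0`. -/
lemma hasDerivAt_momentum_energyProfile (hf : IsSignedReaction f α k) (hc : 0 ≤ c) {s : ℝ}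
    (hs : s ∈ Icc (0 : ℝ) 1) (hpos : 0 < energyProfile γ c f s) :
    HasDerivAt (fun s => momentum γ (energyProfile γ c f s))
      (c - f s / slope γ (energyProfile γ c f s)) s := by
  have h := (hasDerivAt_momentum (γ := γ) hpos).comp s (hf.hasDerivAt_energyProfile hc hs)
  refine h.congr_deriv ?_
  have := slope_pos (γ := γ) hpos
  field_simp

lemma continuousOn_momentum_energyProfile (hf : IsSignedReaction f α k) (hc : 0 ≤ c) :
    ContinuousOn (fun s => momentum γ (energyProfile γ c f s)) (Icc 0 1) :=
  (continuous_momentum γ).comp_continuousOn (hf.continuousOn_energyProfile hc)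

/-- If the energy is positive then it has a lower bound on `[0, α]`. -/
lemma energyProfile_ge (hf : IsSignedReaction f α k) (hc : 0 < c) (hγ : 0 ≤ γ)
    (h0 : 0 < energyProfile γ c f 0) :
    ∀ s ∈ Ioc 0 α, (c * s) ^ 2 / (2 + γ * (c * s)) ≤ energyProfile γ c f s := by
  intro s hs
  have hsub : Icc 0 α ⊆ Icc 0 1 := Icc_subset_Icc_right hf.mem_Ico.2.le
  have hpos := hf.energyProfile_pos_of_zero_pos hc.le h0
  -- Since `f ≤ 0` here, the momentum satisfies `q' ≥ c` and `q 0 ≥ 0`, hence `q ≥ c s`.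
  have := nonpos_of_deriv_nonpos_of_pos (a := 0) (b := α)
    (D := fun s => c * s - momentum γ (energyProfile γ c f s))
    (D' := fun s => c * 1 - (c - f s / slope γ (energyProfile γ c f s)))
    (ContinuousOn.sub (by fun_prop) ((hf.continuousOn_momentum_energyProfile hc.le).mono hsub))
    (fun s hs => ((hasDerivAt_id s).const_mul c).sub
      (hf.hasDerivAt_momentum_energyProfile hc.le (hsub (Ioo_subset_Icc_self hs))
        (hpos s ⟨hs.1.le, hs.2.trans hf.mem_Ico.2⟩)))
    (fun s hs _ => by
      have h1 := hf.nonpos s (Ioo_subset_Icc_self hs)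
      have h2 := div_nonpos_of_nonpos_of_nonneg h1 (slope_nonneg γ (energyProfile γ c f s))
      linarith)
    (by simpa using momentum_nonneg γ _) s ⟨hs.1.le, hs.2⟩
  have hcs : 0 < c * s := mul_pos hc hs.1
  exact (div_two_add_le_energy hγ hcs.le).trans (le_of_le_momentum hcs (by linarith))

/-- Continuous dependence of the energy on both parameters. -/
lemma abs_energyProfile_sub_le (hf : IsSignedReaction f α k) (hc : 0 ≤ c) {γ' c' : ℝ}
    (hc' : 0 ≤ c') {ε : ℝ} (hε : 0 ≤ ε)
    (h : ∀ y ≤ k, |c' * slope γ' y - c * slope γ y| ≤ ε) :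
    ∀ s ∈ Icc (0 : ℝ) 1, |energyProfile γ' c' f s - energyProfile γ c f s| ≤ ε :=
  (hf.isEnergy hc').abs_sub_le (hf.isEnergy hc) (monotone_const_mul_slope hc') hε
    fun s hs => h _ (hf.energyProfile_le_k hc s hs)

lemma slope_le_sqrt_k (hf : IsSignedReaction f α k) {y : ℝ} (hy : y ≤ k) :
    slope γ y ≤ √(2 * k) :=
  (slope_mono γ hy).trans (slope_le_sqrt hf.k_pos.le)

lemma abs_energyProfile_sub_le_speed (hf : IsSignedReaction f α k) (hc : 0 ≤ c) {c' : ℝ}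
    (hc' : 0 ≤ c') : ∀ s ∈ Icc (0 : ℝ) 1,
      |energyProfile γ c' f s - energyProfile γ c f s| ≤ |c' - c| * √(2 * k) := by
  refine hf.abs_energyProfile_sub_le hc hc' (by positivity) fun y hy => ?_
  rw [← sub_mul, abs_mul, abs_of_nonneg (slope_nonneg γ y)]
  exact mul_le_mul_of_nonneg_left (hf.slope_le_sqrt_k hy) (abs_nonneg _)

lemma abs_energyProfile_sub_le_zero (hf : IsSignedReaction f α k) (hc : 0 ≤ c) {c' : ℝ}
    (hc' : 0 ≤ c') : ∀ s ∈ Icc (0 : ℝ) 1,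
      |energyProfile γ c' f s - energyProfile 0 c f s| ≤
        |c' - c| * √(2 * k) + c * (√(2 * k) * k * γ ^ 2) := by
  have hk := hf.k_pos
  refine hf.abs_energyProfile_sub_le hc hc' (by positivity) fun y hy => ?_
  have h1 : c' * slope γ y - c * slope 0 y =
    (c' - c) * slope γ y + c * (slope γ y - slope 0 y) := by ring
  rw [h1]
  refine (abs_add_le _ _).trans (add_le_add ?_ ?_)
  · rw [abs_mul, abs_of_nonneg (slope_nonneg γ y)]
    exact mul_le_mul_of_nonneg_left (hf.slope_le_sqrt_k hy) (abs_nonneg _)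
  · rw [abs_mul, abs_of_nonneg hc]
    exact mul_le_mul_of_nonneg_left (abs_slope_sub_slope_zero_le hk.le hy) hc

lemma tendsto_energyProfile_speed (hf : IsSignedReaction f α k) {u : Filter ℝ} (hc : 0 ≤ c)
    (hu : u ≤ 𝓝 c) (hpos : ∀ᶠ c' in u, 0 ≤ c') {s : ℝ} (hs : s ∈ Icc (0 : ℝ) 1) :
    Tendsto (fun c' => energyProfile γ c' f s) u (𝓝 (energyProfile γ c f s)) := by
  rw [tendsto_iff_dist_tendsto_zero]
  have h1 : Tendsto (fun c' => |c' - c| * √(2 * k)) u (𝓝 0) := by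
    have : Continuous fun c' => |c' - c| * √(2 * k) := by fun_prop
    simpa using (this.tendsto c).mono_left hu
  refine squeeze_zero' (Eventually.of_forall fun _ => dist_nonneg) ?_ h1
  filter_upwards [hpos] with c' hc'
  exact hf.abs_energyProfile_sub_le_speed hc hc' s hs

lemma tendstoUniformlyOn_energyProfile (hf : IsSignedReaction f α k) {C : ℝ → ℝ} (hc : 0 ≤ c)
    (hC : Tendsto C (𝓝[>] 0) (𝓝 c)) (hpos : ∀ᶠ γ in 𝓝[>] (0 : ℝ), 0 ≤ C γ) :
    TendstoUniformlyOn (fun γ => energyProfile γ (C γ) f) (energyProfile 0 c f) (𝓝[>] 0)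
      (Icc 0 1) := by
  rw [Metric.tendstoUniformlyOn_iff]
  intro ε hε
  have h1 : Tendsto (fun γ => |C γ - c| * √(2 * k) + c * (√(2 * k) * k * γ ^ 2)) (𝓝[>] 0)
      (𝓝 (|c - c| * √(2 * k) + c * (√(2 * k) * k * 0 ^ 2))) := by
    refine ((hC.sub_const c).abs.mul_const _).add (Tendsto.const_mul _ (Tendsto.const_mul _ ?_))
    exact ((continuous_pow 2).tendsto (0 : ℝ)).mono_left nhdsWithin_le_nhds
  simp only [sub_self, abs_zero, zero_mul, ne_eq, OfNat.ofNat_ne_zero, not_false_eq_true,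
    zero_pow, mul_zero, add_zero] at h1
  filter_upwards [hpos, h1.eventually_lt_const hε] with γ h2 h3 s hs
  rw [dist_comm]
  exact (hf.abs_energyProfile_sub_le_zero hc h2 s hs).trans_lt h3

end IsSignedReaction

end BornInfeld

/-! ### Admissible speeds, the minimal speed and its limit as `γ → 0⁺`. -/

namespace BornInfeld

/-- The energy equation with speed `c` has a solution which is positive on `(0, 1)` and vanishes
at both ends. -/
structure HasFrontEnergy (γ c : ℝ) (f : ℝ → ℝ) : Prop where
  speed_nonneg : 0 ≤ c
  map_zero : energyProfile γ c f 0 = 0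
  pos : ∀ s ∈ Ioo (0 : ℝ) 1, 0 < energyProfile γ c f s

/-- The least speed for which the energy is nonpositive at `0`. -/
noncomputable def minimalSpeed (γ : ℝ) (f : ℝ → ℝ) : ℝ :=
  sInf {c | 0 ≤ c ∧ energyProfile γ c f 0 ≤ 0}

namespace IsSignedReaction

variable {f : ℝ → ℝ} {α k γ c : ℝ}

lemma minimalSpeed_le (hc : 0 ≤ c) (h : energyProfile γ c f 0 ≤ 0) : minimalSpeed γ f ≤ c :=
  csInf_le ⟨0, fun _ h => h.1⟩ ⟨hc, h⟩

lemma minimalSpeed_nonneg (γ : ℝ) (f : ℝ → ℝ) : 0 ≤ minimalSpeed γ f :=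
  Real.sInf_nonneg fun _ h => h.1

lemma energyProfile_zero_pos_of_lt (hc : 0 ≤ c) (h : c < minimalSpeed γ f) :
    0 < energyProfile γ c f 0 := by
  by_contra! h0
  exact absurd (minimalSpeed_le hc h0) (not_le.2 h)

lemma energyProfile_zero_nonpos_of_gt (hf : IsSignedReaction f α k)
    (h : minimalSpeed γ f < c) : energyProfile γ c f 0 ≤ 0 := by
  have hk := hf.k_pos
  -- With `A = 1/2` and `m = k`, the supersolution condition of `energyProfile_le_sq` reads `(1 +
  -- k)(1 + γ²/2) ≤ c`.
  have hne : {c | 0 ≤ c ∧ energyProfile γ c f 0 ≤ 0}.Nonempty := by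
    have h0 : 0 ≤ (1 + k) * (1 + γ ^ 2 * (1 / 2)) := by positivity
    refine ⟨_, h0, ?_⟩
    have := hf.energyProfile_le_sq (γ := γ) h0 (A := 1 / 2) (m := k) (by norm_num)
      (fun s hs => le_of_abs_le (hf.abs_le_left s hs)) (by norm_num) 0 (by norm_num)
    simpa using this
  obtain ⟨c', hc', hlt⟩ := exists_lt_of_csInf_lt hne h
  exact (hf.energyProfile_anti hc'.1 hlt.le 0 (by norm_num)).trans hc'.2

/-- The minimal speed is admissible. -/
lemma hasFrontEnergy_minimalSpeed (hf : IsSignedReaction f α k) (hγ : 0 ≤ γ) :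
    HasFrontEnergy γ (minimalSpeed γ f) f := by
  have h0 : (0 : ℝ) ∈ Icc (0 : ℝ) 1 := by norm_num
  have hle : energyProfile γ (minimalSpeed γ f) f 0 ≤ 0 := by
    refine le_of_tendsto (hf.tendsto_energyProfile_speed (u := 𝓝[>] minimalSpeed γ f)
      (minimalSpeed_nonneg γ f) nhdsWithin_le_nhds ?_ h0) ?_
    · filter_upwards [self_mem_nhdsWithin] with c hc
      exact (minimalSpeed_nonneg γ f).trans (le_of_lt hc)
    · filter_upwards [self_mem_nhdsWithin] with c hc
      exact hf.energyProfile_zero_nonpos_of_gt hc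
  -- At minimal speed `0` there are no smaller nonnegative speeds to approximate from; the energy is
  -- then `∫ f` over `[s, 1]`, whose sign is assumed.
  rcases (minimalSpeed_nonneg γ f).eq_or_lt with hz | hpos
  · rw [← hz] at hle ⊢
    refine ⟨le_rfl, hle.antisymm ?_, fun s hs => ?_⟩
    · rw [hf.energyProfile_speed_zero h0]; exact hf.integral_nonneg
    · rw [hf.energyProfile_speed_zero (Ioo_subset_Icc_self hs)]; exact hf.integral_pos s hs
  -- Otherwise approach from below, where energies are positive at `0`. Positivity on `(0, α]`
  -- survives the limit thanks to the explicit bound `energyProfile_ge`.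
  · have hev : ∀ᶠ c in 𝓝[<] minimalSpeed γ f, 0 < c ∧ c < minimalSpeed γ f :=
      Ioo_mem_nhdsLT hpos
    have hlim : ∀ s ∈ Icc (0 : ℝ) 1, Tendsto (fun c => energyProfile γ c f s)
        (𝓝[<] minimalSpeed γ f) (𝓝 (energyProfile γ (minimalSpeed γ f) f s)) := fun s hs =>
      hf.tendsto_energyProfile_speed hpos.le nhdsWithin_le_nhds
        (hev.mono fun c hc => hc.1.le) hs
    refine ⟨hpos.le, hle.antisymm (ge_of_tendsto (hlim 0 h0) ?_), fun s hs => ?_⟩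
    · filter_upwards [hev] with c hc
      exact (energyProfile_zero_pos_of_lt hc.1.le hc.2).le
    · rcases le_or_gt s α with hsα | hsα
      · have h1 : Tendsto (fun c => (c * s) ^ 2 / (2 + γ * (c * s))) (𝓝[<] minimalSpeed γ f)
            (𝓝 ((minimalSpeed γ f * s) ^ 2 / (2 + γ * (minimalSpeed γ f * s)))) := by
          have hs0 := hs.1
          have : ContinuousAt (fun c => (c * s) ^ 2 / (2 + γ * (c * s))) (minimalSpeed γ f) := by
            apply ContinuousAt.div (by fun_prop) (by fun_prop)
            positivity
          exact this.tendsto.mono_left nhdsWithin_le_nhds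
        have h2 := le_of_tendsto_of_tendsto h1 (hlim s (Ioo_subset_Icc_self hs)) (by
          filter_upwards [hev] with c hc
          exact hf.energyProfile_ge hc.1 hγ (energyProfile_zero_pos_of_lt hc.1.le hc.2) s
            ⟨hs.1, hsα⟩)
        refine lt_of_lt_of_le ?_ h2
        have hs0 := hs.1
        positivity
      · exact hf.energyProfile_pos_right hpos.le s ⟨hsα, hs.2⟩

lemma minimalSpeed_le_of_hasFrontEnergy (h : HasFrontEnergy γ c f) : minimalSpeed γ f ≤ c :=
  minimalSpeed_le h.speed_nonneg h.map_zero.le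

/-- In the monostable case, all speeds above the minimal one are admissible. -/
lemma hasFrontEnergy_iff_of_monostable (hf : IsSignedReaction f 0 k) (hγ : 0 ≤ γ) :
    HasFrontEnergy γ c f ↔ minimalSpeed γ f ≤ c := by
  refine ⟨minimalSpeed_le_of_hasFrontEnergy, fun h => ?_⟩
  have h0 := minimalSpeed_nonneg γ f
  have hm := hf.hasFrontEnergy_minimalSpeed hγ
  have hc := h0.trans h
  have hpos := hf.energyProfile_pos_right (γ := γ) hc
  refine ⟨hc, le_antisymm ?_ ?_, hpos⟩
  · exact (hf.energyProfile_anti h0 h 0 (by norm_num)).trans hm.map_zero.le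
  · have hcont := (hf.continuousOn_energyProfile (γ := γ) hc 0 (by norm_num)).mono
      Ioo_subset_Icc_self
    have : (𝓝[Ioo 0 1] (0 : ℝ)).NeBot := by
      rw [nhdsWithin_Ioo_eq_nhdsGT zero_lt_one]; infer_instance
    refine ge_of_tendsto hcont.tendsto ?_
    filter_upwards [self_mem_nhdsWithin] with s hs
    exact (hpos s hs).le

/-- In the bistable and combustion cases there is at most one admissible speed. -/
lemma not_hasFrontEnergy_of_lt (hf : IsSignedReaction f α k) (hα : 0 < α) {c' : ℝ}
    (h : HasFrontEnergy γ c f) (hcc : c < c') : ¬ HasFrontEnergy γ c' f := by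
  intro h'
  have hsub : Icc 0 α ⊆ Icc 0 1 := Icc_subset_Icc_right hf.mem_Ico.2.le
  have hsub' : Ioo 0 α ⊆ Ioo 0 1 := Ioo_subset_Ioo_right hf.mem_Ico.2.le
  have hanti := hf.energyProfile_anti (γ := γ) h.speed_nonneg hcc.le
  -- The larger speed has the smaller slope, and `f ≤ 0`, so its momentum gains on the other at rate
  -- at least `c' - c`. It is then strictly larger at `α`, against `energyProfile_anti`.
  have := nonpos_of_deriv_nonpos_of_pos (a := 0) (b := α)
    (D := fun s => momentum γ (energyProfile γ c f s) - momentum γ (energyProfile γ c' f s)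
      + (c' - c) * s)
    (D' := fun s => (c - f s / slope γ (energyProfile γ c f s)) -
      (c' - f s / slope γ (energyProfile γ c' f s)) + (c' - c) * 1)
    ((((hf.continuousOn_momentum_energyProfile h.speed_nonneg).sub
      (hf.continuousOn_momentum_energyProfile h'.speed_nonneg)).mono hsub).add (by fun_prop))
    (fun s hs => ((hf.hasDerivAt_momentum_energyProfile h.speed_nonneg
      (hsub (Ioo_subset_Icc_self hs)) (h.pos s (hsub' hs))).sub
      (hf.hasDerivAt_momentum_energyProfile h'.speed_nonneg
      (hsub (Ioo_subset_Icc_self hs)) (h'.pos s (hsub' hs)))).add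
      ((hasDerivAt_id s).const_mul _))
    (fun s hs _ => by
      have h1 := hf.nonpos s (Ioo_subset_Icc_self hs)
      have h2 := slope_mono γ (hanti s (hsub (Ioo_subset_Icc_self hs)))
      have h3 := slope_pos (γ := γ) (h'.pos s (hsub' hs))
      have h4 : -f s / slope γ (energyProfile γ c f s) ≤
          -f s / slope γ (energyProfile γ c' f s) :=
        div_le_div_of_nonneg_left (by linarith) h3 h2
      rw [neg_div, neg_div] at h4
      linarith)
    (by simp [h.map_zero, h'.map_zero]) α (right_mem_Icc.2 hα.le)
  have h2 := momentum_mono γ (hanti α (hsub (right_mem_Icc.2 hα.le)))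
  have h3 : 0 < (c' - c) * α := mul_pos (sub_pos.2 hcc) hα
  linarith

lemma hasFrontEnergy_iff_eq (hf : IsSignedReaction f α k) (hα : 0 < α) (hγ : 0 ≤ γ) :
    HasFrontEnergy γ c f ↔ c = minimalSpeed γ f := by
  have hm := hf.hasFrontEnergy_minimalSpeed hγ
  refine ⟨fun h => ?_, fun h => h ▸ hm⟩
  rcases lt_trichotomy c (minimalSpeed γ f) with h1 | h1 | h1
  · exact absurd hm (hf.not_hasFrontEnergy_of_lt hα h h1)
  · exact h1
  · exact absurd h (hf.not_hasFrontEnergy_of_lt hα hm h1)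

/-- `A = m/2` minimises `(2A + m) / √(2A)`, with minimum `2√m`. -/
lemma minimalSpeed_le_kpp (hf : IsSignedReaction f α k) {m : ℝ} (hm : 0 < m)
    (hfm : ∀ s ∈ Icc (0 : ℝ) 1, f s ≤ m * s) :
    minimalSpeed γ f ≤ 2 * √m * (1 + γ ^ 2 * (m / 2)) := by
  refine minimalSpeed_le (by positivity) ?_
  have := hf.energyProfile_le_sq (γ := γ) (c := 2 * √m * (1 + γ ^ 2 * (m / 2))) (by positivity)
    (A := m / 2) (by positivity) hfm (by
      rw [mul_div_cancel₀ _ (two_ne_zero)]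
      have := Real.mul_self_sqrt hm.le
      apply le_of_eq
      linear_combination (-2 * (1 + γ ^ 2 * (m / 2))) * this) 0 (by norm_num)
  simpa using this

lemma momentum_le_mul (hf : IsSignedReaction f 0 k) (h : HasFrontEnergy γ c f) :
    ∀ s ∈ Icc (0 : ℝ) 1, momentum γ (energyProfile γ c f s) ≤ c * s := by
  intro s hs
  have := nonpos_of_deriv_nonpos_of_pos (a := 0) (b := 1)
    (D := fun s => momentum γ (energyProfile γ c f s) - c * s)
    (D' := fun s => (c - f s / slope γ (energyProfile γ c f s)) - c * 1)
    ((hf.continuousOn_momentum_energyProfile h.speed_nonneg).sub (by fun_prop))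
    (fun s hs => (hf.hasDerivAt_momentum_energyProfile h.speed_nonneg
      (Ioo_subset_Icc_self hs) (h.pos s hs)).sub ((hasDerivAt_id s).const_mul c))
    (fun s hs _ => by
      have := div_nonneg (hf.pos s hs).le (slope_nonneg γ (energyProfile γ c f s))
      linarith)
    (by simp [h.map_zero, momentum]) s hs
  linarith

/-- The linearisation at `0` gives a lower bound for the admissible speeds. -/
lemma two_sqrt_le_of_hasFrontEnergy (hf : IsSignedReaction f 0 k) {m : ℝ}
    (hm : HasDerivWithinAt f m (Icc 0 1) 0) (hf0 : f 0 = 0) (h : HasFrontEnergy γ c f) :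
    2 * √m ≤ c := by
  by_contra! hlt
  have hc := h.speed_nonneg
  have hm0 : 0 < m := by
    by_contra! hm0
    rw [Real.sqrt_eq_zero_of_nonpos hm0] at hlt
    linarith
  have hcm : c ^ 2 / 4 < m := by
    have := Real.sq_sqrt hm0.le
    nlinarith [Real.sqrt_nonneg m]
  -- Below the threshold there is room for `μ` with `c < 2√μ` and `f s ≥ μ s` near `0`.
  obtain ⟨μ, hμ1, hμ2⟩ := exists_between hcm
  have hμ0 : 0 < μ := lt_of_le_of_lt (by positivity) hμ1
  have hδ : 0 < 2 * √μ - c := by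
    have := Real.sq_sqrt hμ0.le
    nlinarith [Real.sqrt_nonneg μ]
  have hev : ∀ᶠ s in 𝓝[>] (0 : ℝ), μ * s ≤ f s := by
    have h1 := hasDerivWithinAt_iff_tendsto_slope.1 hm
    have h2 : 𝓝[>] (0 : ℝ) ≤ 𝓝[Icc 0 1 \ {0}] 0 := by
      rw [Icc_sdiff_left, nhdsWithin_Ioc_eq_nhdsGT zero_lt_one]
    filter_upwards [(h1.mono_left h2).eventually_const_lt hμ2, self_mem_nhdsWithin]
      with s hs hs0
    have hs0 : 0 < s := hs0
    rw [slope_def_field, hf0, sub_zero, sub_zero, lt_div_iff₀ hs0] at hs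
    exact hs.le
  obtain ⟨s₀, hs₀, hs₀'⟩ := (mem_nhdsGT_iff_exists_Ioo_subset).1
    (inter_mem hev (Ioo_mem_nhdsGT (zero_lt_one (α := ℝ))))
  have hs₀0 : 0 < s₀ := hs₀
  set q := fun s => momentum γ (energyProfile γ c f s) with hq
  have hder : ∀ s ∈ Ioo 0 s₀, HasDerivAt (fun s => q s / s + (2 * √μ - c) * Real.log s)
      (((c - f s / slope γ (energyProfile γ c f s)) * s - q s * 1) / s ^ 2 +
        (2 * √μ - c) * s⁻¹) s := fun s hs =>
    ((hf.hasDerivAt_momentum_energyProfile hc (Ioo_subset_Icc_self (hs₀' hs).2)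
      (h.pos s (hs₀' hs).2)).div (hasDerivAt_id s) hs.1.ne').add
      ((Real.hasDerivAt_log hs.1.ne').const_mul _)
  -- For `x = q/s`, the bounds `slope ≤ q` and `f ≥ μ s` give `s x' ≤ c - μ/x - x ≤ c - 2√μ < 0`. So
  -- `x` blows up at least logarithmically as `s → 0⁺`, against `q ≤ c s` from `momentum_le_mul`.
  have hanti : AntitoneOn (fun s => q s / s + (2 * √μ - c) * Real.log s) (Ioo 0 s₀) := by
    apply antitoneOn_of_hasDerivWithinAt_nonpos (convex_Ioo 0 s₀)
    · exact fun s hs => (hder s hs).continuousAt.continuousWithinAt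
    · intro s hs
      rw [interior_Ioo] at hs
      exact (hder s hs).hasDerivWithinAt
    · intro s hs
      rw [interior_Ioo] at hs
      have hs0 : 0 < s := hs.1
      have hy := h.pos s (hs₀' hs).2
      have hR := slope_pos (γ := γ) hy
      have hq0 : 0 < q s := momentum_pos hy
      have h1 : μ * s / q s ≤ f s / slope γ (energyProfile γ c f s) :=
        div_le_div₀ (hf.pos s (hs₀' hs).2).le (hs₀' hs).1 hR (slope_le_momentum _ _)
      have h2 : 2 * √μ * s ≤ μ * s / q s * s + q s := by
        have h3 := Real.sq_sqrt hμ0.le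
        have h4 : μ * s / q s * s + q s - 2 * √μ * s = (√μ * s - q s) ^ 2 / q s := by
          field_simp
          linear_combination (-s ^ 2) * h3
        have h5 : 0 ≤ (√μ * s - q s) ^ 2 / q s := by positivity
        linarith
      have h6 : ((c - f s / slope γ (energyProfile γ c f s)) * s - q s * 1) / s ^ 2 +
          (2 * √μ - c) * s⁻¹ = ((c - f s / slope γ (energyProfile γ c f s)) * s - q s +
          (2 * √μ - c) * s) / s ^ 2 := by
        field_simp
      rw [h6]
      apply div_nonpos_of_nonpos_of_nonneg _ (by positivity)
      nlinarith [mul_le_mul_of_nonneg_right h1 hs0.le]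
  have hlog : Tendsto (fun s => c + (2 * √μ - c) * Real.log s) (𝓝[>] 0) atBot :=
    tendsto_atBot_add_const_left _ _ (Real.tendsto_log_nhdsGT_zero.const_mul_atBot hδ)
  have hmid : s₀ / 2 ∈ Ioo 0 s₀ := ⟨by positivity, by linarith⟩
  obtain ⟨s, hs1, hs2⟩ := ((hlog.eventually_lt_atBot
    (q (s₀ / 2) / (s₀ / 2) + (2 * √μ - c) * Real.log (s₀ / 2))).and
    (Ioo_mem_nhdsGT (show 0 < s₀ / 2 by positivity))).exists
  have h1 := hanti ⟨hs2.1, hs2.2.trans hmid.2⟩ hmid hs2.2.le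
  have h2 : q s / s ≤ c := by
    rw [div_le_iff₀ hs2.1]
    exact hf.momentum_le_mul h s
      (Ioo_subset_Icc_self (hs₀' ⟨hs2.1, hs2.2.trans hmid.2⟩).2)
  simp only at h1
  linarith

lemma tendsto_minimalSpeed_kpp (hf : IsSignedReaction f 0 k) {m : ℝ}
    (hm : HasDerivWithinAt f m (Icc 0 1) 0) (hf0 : f 0 = 0) (hm0 : 0 < m)
    (hfm : ∀ s ∈ Icc (0 : ℝ) 1, f s ≤ m * s) :
    minimalSpeed 0 f = 2 * √m ∧
      Tendsto (fun γ => minimalSpeed γ f) (𝓝[>] 0) (𝓝 (minimalSpeed 0 f)) := by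
  have hlow : ∀ γ, 0 ≤ γ → 2 * √m ≤ minimalSpeed γ f := fun γ hγ =>
    hf.two_sqrt_le_of_hasFrontEnergy hm hf0 (hf.hasFrontEnergy_minimalSpeed hγ)
  have h0 : minimalSpeed 0 f = 2 * √m :=
    le_antisymm (by simpa using hf.minimalSpeed_le_kpp (γ := 0) hm0 hfm) (hlow 0 le_rfl)
  refine ⟨h0, h0 ▸ tendsto_of_tendsto_of_tendsto_of_le_of_le' tendsto_const_nhds
    (h := fun γ => 2 * √m * (1 + γ ^ 2 * (m / 2))) ?_ ?_
    (Eventually.of_forall fun γ => hf.minimalSpeed_le_kpp hm0 hfm)⟩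
  · have : Continuous fun γ : ℝ => 2 * √m * (1 + γ ^ 2 * (m / 2)) := by fun_prop
    simpa using (this.tendsto 0).mono_left nhdsWithin_le_nhds
  · filter_upwards [self_mem_nhdsWithin] with γ hγ
    exact hlow γ (le_of_lt hγ)

/-- Below the limit speed, `y 0 > 0` at `γ = 0` is an open condition. Above it, at some `a >
minimalSpeed 0 f`, energies positive at `0` for arbitrarily small `γ` would, by `energyProfile_ge`,
have a limit that is a front energy of speed `a` at `γ = 0`. That would be a second admissible
speed. -/
lemma tendsto_minimalSpeed (hf : IsSignedReaction f α k) (hα : 0 < α) :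
    Tendsto (fun γ => minimalSpeed γ f) (𝓝[>] 0) (𝓝 (minimalSpeed 0 f)) := by
  have h0 : (0 : ℝ) ∈ Icc (0 : ℝ) 1 := by norm_num
  have hm0 := hf.hasFrontEnergy_minimalSpeed le_rfl
  have hlim : ∀ {c}, 0 ≤ c → ∀ s ∈ Icc (0 : ℝ) 1, Tendsto (fun γ => energyProfile γ c f s)
      (𝓝[>] 0) (𝓝 (energyProfile 0 c f s)) := fun hc s hs =>
    (hf.tendstoUniformlyOn_energyProfile hc tendsto_const_nhds
      (Eventually.of_forall fun _ => hc)).tendsto_at hs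
  refine tendsto_order.2 ⟨fun a ha => ?_, fun b hb => ?_⟩
  · rcases lt_or_ge a 0 with ha0 | ha0
    · exact Eventually.of_forall fun γ => ha0.trans_le (minimalSpeed_nonneg γ f)
    · obtain ⟨b, hab, hb⟩ := exists_between ha
      have hb0 := ha0.trans hab.le
      filter_upwards [(hlim hb0 0 h0).eventually_const_lt (energyProfile_zero_pos_of_lt hb0 hb),
        self_mem_nhdsWithin] with γ hγ hγ0
      refine hab.trans_le ?_
      by_contra! hlt
      have := hf.energyProfile_anti (γ := γ) (minimalSpeed_nonneg γ f) hlt.le 0 h0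
      rw [(hf.hasFrontEnergy_minimalSpeed (le_of_lt hγ0)).map_zero] at this
      linarith
  · obtain ⟨a, ha, hab⟩ := exists_between hb
    have ha0 := (minimalSpeed_nonneg 0 f).trans_lt ha
    suffices h : ∀ᶠ γ in 𝓝[>] 0, energyProfile γ a f 0 ≤ 0 by
      filter_upwards [h] with γ hγ
      exact (minimalSpeed_le ha0.le hγ).trans_lt hab
    by_contra hne
    have hfr : ∃ᶠ γ in 𝓝[>] (0 : ℝ), 0 < γ ∧ 0 < energyProfile γ a f 0 := by
      have h1 := not_eventually.1 hne
      refine (h1.and_eventually self_mem_nhdsWithin).mono fun γ hγ => ⟨hγ.2, not_le.1 hγ.1⟩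
    refine hf.not_hasFrontEnergy_of_lt hα hm0 ha ⟨ha0.le, le_antisymm ?_ ?_, fun s hs => ?_⟩
    · exact (hf.energyProfile_anti hm0.speed_nonneg ha.le 0 h0).trans hm0.map_zero.le
    · exact ge_of_tendsto_of_frequently (hlim ha0.le 0 h0) (hfr.mono fun γ hγ => hγ.2.le)
    · rcases le_or_gt s α with hsα | hsα
      · have hs0 := hs.1
        have h1 : Tendsto (fun γ => energyProfile γ a f s - (a * s) ^ 2 / (2 + γ * (a * s)))
            (𝓝[>] 0) (𝓝 (energyProfile 0 a f s - (a * s) ^ 2 / (2 + 0 * (a * s)))) := by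
          refine (hlim ha0.le s (Ioo_subset_Icc_self hs)).sub ?_
          have : ContinuousAt (fun γ => (a * s) ^ 2 / (2 + γ * (a * s))) 0 := by
            apply ContinuousAt.div (by fun_prop) (by fun_prop)
            norm_num
          exact this.tendsto.mono_left nhdsWithin_le_nhds
        have h2 := ge_of_tendsto_of_frequently h1 (hfr.mono fun γ hγ => sub_nonneg.2
          (hf.energyProfile_ge ha0 hγ.1.le hγ.2 s ⟨hs.1, hsα⟩))
        have h3 : 0 < (a * s) ^ 2 / (2 + 0 * (a * s)) := by positivity
        linarith
      · exact hf.energyProfile_pos_right ha0.le s ⟨hsα, hs.2⟩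

end IsSignedReaction

end BornInfeld

/-! ### From fronts to energies: the phase plane. -/

namespace BornInfeld

/-- A front as a solution of the first order system for the profile `v` and the flux `w`. -/
structure IsPhaseFront (γ c : ℝ) (f v w : ℝ → ℝ) : Prop where
  hasDerivAt_fst : ∀ z, HasDerivAt v (velocity γ (w z)) z
  hasDerivAt_snd : ∀ z, HasDerivAt w (c * velocity γ (w z) - f (v z)) z
  nonneg : ∀ z, 0 ≤ w z
  tendsto_atBot : Tendsto v atBot (𝓝 0)
  tendsto_atTop : Tendsto v atTop (𝓝 1)

lemma IsFront.isPhaseFront {γ c : ℝ} {f v : ℝ → ℝ} (h : IsFront γ c f v) :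
    IsPhaseFront γ c f v (fun x => deriv v x / √(1 - γ ^ 2 * deriv v x ^ 2)) := by
  have hpos : ∀ z, 0 < 1 - γ ^ 2 * deriv v z ^ 2 := fun z => by linarith [h.field_lt z]
  have hv : Differentiable ℝ v := h.contDiff.differentiable (by norm_num)
  have hv' : Differentiable ℝ (deriv v) := by
    have h1 : ContDiff ℝ (1 + 1) v := by simpa [one_add_one_eq_two] using h.contDiff
    exact ((contDiff_succ_iff_deriv.1 h1).2.2).differentiable (by norm_num)
  -- The outer `deriv` in the equation is a genuine derivative, not the default value `0`, because
  -- `v` is `C²` and the root stays positive.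
  have hw : ∀ z, DifferentiableAt ℝ (fun x => deriv v x / √(1 - γ ^ 2 * deriv v x ^ 2)) z :=
    fun z => (hv' z).div ((((hv' z).pow 2).const_mul _ |>.const_sub 1).sqrt (hpos z).ne')
      (Real.sqrt_pos.2 (hpos z)).ne'
  have hvel : ∀ z, velocity γ (deriv v z / √(1 - γ ^ 2 * deriv v z ^ 2)) = deriv v z :=
    fun z => velocity_flux (h.field_lt z)
  refine ⟨fun z => ?_, fun z => ?_, fun z => ?_, h.tendsto_atBot, h.tendsto_atTop⟩
  · rw [hvel]; exact (hv z).hasDerivAt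
  · rw [hvel]
    refine (hw z).hasDerivAt.congr_deriv ?_
    linarith [h.equation z]
  · exact div_nonneg h.monotone.deriv_nonneg (Real.sqrt_nonneg _)

/-- A nonnegative function with `|N'| ≤ K N` which vanishes at a point vanishes identically. -/
lemma eq_zero_of_abs_deriv_le {N N' : ℝ → ℝ} {K z₀ : ℝ} (hN : ∀ z, 0 ≤ N z)
    (hd : ∀ z, HasDerivAt N (N' z) z) (hK : ∀ z, |N' z| ≤ K * N z) (h0 : N z₀ = 0) (z : ℝ) :
    N z = 0 := by
  have hexp : ∀ a z : ℝ, HasDerivAt (fun z => N z * Real.exp (a * z))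
      ((N' z + a * N z) * Real.exp (a * z)) z := fun a z => by
    have h1 := (hd z).mul (((hasDerivAt_id z).const_mul a).exp)
    refine h1.congr_deriv ?_
    simp only [id, mul_one]
    ring
  have hm : Monotone fun z => N z * Real.exp (K * z) :=
    monotone_of_hasDerivAt_nonneg (hexp K) fun z =>
      mul_nonneg (by linarith [neg_le_of_abs_le (hK z)]) (Real.exp_pos _).le
  have ha : Antitone fun z => N z * Real.exp (-K * z) :=
    antitone_of_hasDerivAt_nonpos (hexp (-K)) fun z =>
      mul_nonpos_of_nonpos_of_nonneg (by linarith [le_of_abs_le (hK z)]) (Real.exp_pos _).le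
  refine le_antisymm ?_ (hN z)
  rcases le_total z z₀ with h | h
  · have := hm h
    simp only [h0, zero_mul] at this
    exact nonpos_of_mul_nonpos_left this (Real.exp_pos _)
  · have := ha h
    simp only [h0, zero_mul] at this
    exact nonpos_of_mul_nonpos_left this (Real.exp_pos _)

namespace IsPhaseFront

variable {γ c k α : ℝ} {f v w : ℝ → ℝ}

lemma monotone (h : IsPhaseFront γ c f v w) : Monotone v :=
  monotone_of_hasDerivAt_nonneg h.hasDerivAt_fst fun z => velocity_nonneg (h.nonneg z)

lemma mem_Icc (h : IsPhaseFront γ c f v w) (z : ℝ) : v z ∈ Icc (0 : ℝ) 1 :=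
  ⟨h.monotone.le_of_tendsto h.tendsto_atBot z, h.monotone.ge_of_tendsto h.tendsto_atTop z⟩

lemma continuous_fst (h : IsPhaseFront γ c f v w) : Continuous v :=
  continuous_iff_continuousAt.2 fun z => (h.hasDerivAt_fst z).continuousAt

/-- If `v` hardly varies on `[z, z + t]`, the mean value theorem finds a point `ξ` there with small
flux. Between `z` and `ξ`, `w - c v` has derivative `-f v ≥ -k`, so `w z` exceeds `w ξ` by at most
`k t` plus a multiple of the variation of `v`. With `t = ε/(4k)` each contribution is at most `ε/4`.
-/
lemma tendsto_flux (h : IsPhaseFront γ c f v w) (hf : IsSignedReaction f α k) {l : Filter ℝ}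
    (hl : ∀ t : ℝ, 0 < t → Tendsto (fun z => v (z + t) - v z) l (𝓝 0)) :
    Tendsto w l (𝓝 0) := by
  have hk := hf.k_pos
  refine tendsto_order.2 ⟨fun a ha => Eventually.of_forall fun z => ha.trans_le (h.nonneg z),
    fun ε hε => ?_⟩
  have ht : 0 < ε / (4 * k) := by positivity
  set t := ε / (4 * k) with ht_def
  have hkt : k * t = ε / 4 := by rw [ht_def]; field_simp
  have hψ : 0 < t * velocity γ (ε / 4) := mul_pos ht (velocity_pos_iff.2 (by positivity))
  have hε' : 0 < ε / (4 * (|c| + 1)) := by positivity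
  filter_upwards [(hl t ht).eventually_lt_const hψ, (hl t ht).eventually_lt_const hε']
    with z h1 h2
  obtain ⟨ξ, hξ, hξ'⟩ := exists_hasDerivAt_eq_slope v (fun z => velocity γ (w z))
    (show z < z + t by linarith) h.continuous_fst.continuousOn fun z _ => h.hasDerivAt_fst z
  rw [add_sub_cancel_left, eq_div_iff ht.ne'] at hξ'
  have h3 : w ξ < ε / 4 := by
    rw [← (velocity_strictMono γ).lt_iff_lt]
    nlinarith
  obtain ⟨η, hη, hη'⟩ := exists_hasDerivAt_eq_slope (fun z => w z - c * v z)
    (fun z => (c * velocity γ (w z) - f (v z)) - c * velocity γ (w z)) hξ.1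
    (fun z _ => ((h.hasDerivAt_snd z).sub
      ((h.hasDerivAt_fst z).const_mul c)).continuousAt.continuousWithinAt)
    fun z _ => (h.hasDerivAt_snd z).sub ((h.hasDerivAt_fst z).const_mul c)
  have hξz : 0 < ξ - z := sub_pos.2 hξ.1
  rw [eq_div_iff hξz.ne'] at hη'
  have h4 : f (v η) ≤ k := by
    have := le_of_abs_le (hf.abs_le_left _ (h.mem_Icc η))
    nlinarith [(h.mem_Icc η).2]
  have h5 : f (v η) * (ξ - z) ≤ k * t := by
    have : ξ - z ≤ t := by linarith [hξ.2]
    nlinarith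
  have h6 : -(c * (v ξ - v z)) ≤ ε / 4 := by
    have h7 : 0 ≤ v ξ - v z := sub_nonneg.2 (h.monotone hξ.1.le)
    have h8 : v ξ - v z ≤ v (z + t) - v z := by linarith [h.monotone hξ.2.le]
    have h9 : (|c| + 1) * (v (z + t) - v z) < ε / 4 := by
      rw [lt_div_iff₀ (by positivity)] at h2
      linarith
    have h10 : -(c * (v ξ - v z)) ≤ (|c| + 1) * (v ξ - v z) := by
      nlinarith [neg_abs_le c]
    have h11 : (|c| + 1) * (v ξ - v z) ≤ (|c| + 1) * (v (z + t) - v z) := by gcongr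
    linarith
  nlinarith

lemma tendsto_flux_atTop (h : IsPhaseFront γ c f v w) (hf : IsSignedReaction f α k) :
    Tendsto w atTop (𝓝 0) :=
  h.tendsto_flux hf fun t _ => by
    simpa using (h.tendsto_atTop.comp (tendsto_atTop_add_const_right atTop t tendsto_id)).sub
      h.tendsto_atTop

lemma tendsto_flux_atBot (h : IsPhaseFront γ c f v w) (hf : IsSignedReaction f α k) :
    Tendsto w atBot (𝓝 0) :=
  h.tendsto_flux hf fun t _ => by
    simpa using (h.tendsto_atBot.comp (tendsto_atBot_add_const_right atBot t tendsto_id)).sub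
      h.tendsto_atBot

lemma exists_flux_ne_zero (h : IsPhaseFront γ c f v w) : ∃ z, w z ≠ 0 := by
  by_contra! h0
  have hconst : ∀ z, v z = v 0 := fun z =>
    is_const_of_deriv_eq_zero (fun z => (h.hasDerivAt_fst z).differentiableAt)
      (fun z => by rw [(h.hasDerivAt_fst z).deriv, h0 z, velocity_zero]) z 0
  have h1 := h.tendsto_atBot
  have h2 := h.tendsto_atTop
  rw [show v = fun _ => v 0 from funext hconst] at h1 h2
  have h3 := tendsto_nhds_unique h1 tendsto_const_nhds
  have h4 := tendsto_nhds_unique h2 tendsto_const_nhds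
  linarith

/-- Energy identity: `energy γ w` plus the potential of `v` has derivative `c v'²` and runs from `0`
to `∫ f ≥ 0`. With `c < 0` it would be constant, so `v' = 0` everywhere. -/
lemma speed_nonneg (h : IsPhaseFront γ c f v w) (hf : IsSignedReaction f α k) : 0 ≤ c := by
  by_contra! hc
  have hF : ∀ s, HasDerivAt (fun s => ∫ t in (0 : ℝ)..s, f t) (f s) s := fun s =>
    intervalIntegral.integral_hasDerivAt_right (hf.continuous.intervalIntegrable 0 s)
      (hf.continuous.stronglyMeasurableAtFilter _ _) hf.continuous.continuousAt
  have hE : ∀ z, HasDerivAt (fun z => energy γ (w z) + ∫ t in (0 : ℝ)..v z, f t)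
      (c * velocity γ (w z) ^ 2) z := fun z => by
    have h1 := ((hasDerivAt_energy γ (w z)).comp z (h.hasDerivAt_snd z)).add
      ((hF (v z)).comp z (h.hasDerivAt_fst z))
    refine h1.congr_deriv ?_
    ring
  have hanti : Antitone fun z => energy γ (w z) + ∫ t in (0 : ℝ)..v z, f t :=
    antitone_of_hasDerivAt_nonpos hE fun z =>
      mul_nonpos_of_nonpos_of_nonneg hc.le (sq_nonneg _)
  have hlim : ∀ {l : Filter ℝ} {a : ℝ}, Tendsto w l (𝓝 0) → Tendsto v l (𝓝 a) →
      Tendsto (fun z => energy γ (w z) + ∫ t in (0 : ℝ)..v z, f t) l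
        (𝓝 (0 + ∫ t in (0 : ℝ)..a, f t)) := fun {l a} hw hv => by
    have h1 := ((continuous_energy γ).tendsto 0).comp hw
    rw [energy_zero] at h1
    exact h1.add ((hF a).continuousAt.tendsto.comp hv)
  have hbot := hlim (h.tendsto_flux_atBot hf) h.tendsto_atBot
  have htop := hlim (h.tendsto_flux_atTop hf) h.tendsto_atTop
  rw [intervalIntegral.integral_same, add_zero] at hbot
  rw [zero_add] at htop
  have hzero : ∀ z, energy γ (w z) + ∫ t in (0 : ℝ)..v z, f t = 0 := fun z =>
    le_antisymm (hanti.ge_of_tendsto hbot z)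
      (hf.integral_nonneg.trans (hanti.le_of_tendsto htop z))
  obtain ⟨z, hz⟩ := h.exists_flux_ne_zero
  have h1 := (hE z).unique ((hasDerivAt_const z (0 : ℝ)).congr_of_eventuallyEq
    (Eventually.of_forall hzero))
  have h2 : velocity γ (w z) = 0 := by simpa [hc.ne] using h1
  exact (velocity_pos_iff.2 ((h.nonneg z).lt_of_ne' hz)).ne' h2

/-- A zero of `v` is a minimum, so the orbit meets the equilibrium `(0, 0)`. The bound `|f s| ≤ k s`
replaces a Lipschitz condition at that point: `v² + w²` satisfies a two-sided Grönwall inequality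
and vanishes identically. -/
lemma fst_pos (h : IsPhaseFront γ c f v w) (hf : IsSignedReaction f α k) (z : ℝ) : 0 < v z := by
  refine (h.mem_Icc z).1.lt_of_ne' fun h0 => ?_
  have hw0 : w z = 0 := by
    have hmin : IsLocalMin v z := Eventually.of_forall fun t => h0 ▸ (h.mem_Icc t).1
    have := hmin.hasDerivAt_eq_zero (h.hasDerivAt_fst z)
    by_contra hne
    exact (velocity_pos_iff.2 ((h.nonneg z).lt_of_ne' hne)).ne' this
  have hN : ∀ t, v t ^ 2 + w t ^ 2 = 0 := by
    refine eq_zero_of_abs_deriv_le (K := 1 + k + 2 * |c|) (z₀ := z)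
      (fun t => by positivity)
      (fun t => ((h.hasDerivAt_fst t).pow 2).add ((h.hasDerivAt_snd t).pow 2)) (fun t => ?_)
      (by simp [h0, hw0])
    have hv := (h.mem_Icc t).1
    have hw := h.nonneg t
    have h1 := velocity_nonneg (γ := γ) hw
    have h2 := velocity_le (γ := γ) hw
    have h3 := hf.abs_le_left _ (h.mem_Icc t)
    have h4 : |c * velocity γ (w t)| ≤ |c| * w t := by
      rw [abs_mul, abs_of_nonneg h1]; gcongr
    have h5 : |c * velocity γ (w t) - f (v t)| ≤ |c| * w t + k * v t :=
      (abs_sub _ _).trans (add_le_add h4 h3)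
    simp only [Nat.cast_ofNat, Nat.add_one_sub_one, pow_one]
    calc _ ≤ |2 * v t * velocity γ (w t)| + |2 * w t * (c * velocity γ (w t) - f (v t))| :=
          abs_add_le _ _
      _ ≤ 2 * v t * w t + 2 * w t * (|c| * w t + k * v t) := by
          rw [abs_of_nonneg (by positivity), abs_mul, abs_of_nonneg (by positivity)]
          gcongr
      _ ≤ _ := by
          have hk := hf.k_pos
          nlinarith [mul_nonneg hk.le (sq_nonneg (v t - w t)), sq_nonneg (v t - w t),
            mul_nonneg (abs_nonneg c) (sq_nonneg (v t))]
  have hv0 : v = fun _ => 0 := funext fun t => by nlinarith [hN t, sq_nonneg (v t), sq_nonneg (w t)]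
  have := h.tendsto_atTop
  rw [hv0] at this
  exact zero_ne_one (tendsto_nhds_unique tendsto_const_nhds this)

/-- The same argument at the equilibrium `(1, 0)`, with the bound `|f s| ≤ k (1 - s)`. -/
lemma fst_lt_one (h : IsPhaseFront γ c f v w) (hf : IsSignedReaction f α k) (z : ℝ) :
    v z < 1 := by
  refine (h.mem_Icc z).2.lt_of_ne fun h0 => ?_
  have hw0 : w z = 0 := by
    have hmax : IsLocalMax v z := Eventually.of_forall fun t => h0 ▸ (h.mem_Icc t).2
    have := hmax.hasDerivAt_eq_zero (h.hasDerivAt_fst z)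
    by_contra hne
    exact (velocity_pos_iff.2 ((h.nonneg z).lt_of_ne' hne)).ne' this
  have hN : ∀ t, (1 - v t) ^ 2 + w t ^ 2 = 0 := by
    refine eq_zero_of_abs_deriv_le (K := 1 + k + 2 * |c|) (z₀ := z)
      (fun t => by positivity)
      (fun t => (((h.hasDerivAt_fst t).const_sub 1).pow 2).add ((h.hasDerivAt_snd t).pow 2))
      (fun t => ?_) (by simp [h0, hw0])
    have hv := sub_nonneg.2 (h.mem_Icc t).2
    have hw := h.nonneg t
    have h1 := velocity_nonneg (γ := γ) hw
    have h2 := velocity_le (γ := γ) hw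
    have h3 := hf.abs_le_right _ (h.mem_Icc t)
    have h4 : |c * velocity γ (w t)| ≤ |c| * w t := by
      rw [abs_mul, abs_of_nonneg h1]; gcongr
    have h5 : |c * velocity γ (w t) - f (v t)| ≤ |c| * w t + k * (1 - v t) :=
      (abs_sub _ _).trans (add_le_add h4 h3)
    simp only [Nat.cast_ofNat, Nat.add_one_sub_one, pow_one]
    calc _ ≤ |2 * (1 - v t) * -velocity γ (w t)| +
          |2 * w t * (c * velocity γ (w t) - f (v t))| := abs_add_le _ _
      _ ≤ 2 * (1 - v t) * w t + 2 * w t * (|c| * w t + k * (1 - v t)) := by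
          rw [mul_neg, abs_neg, abs_of_nonneg (by positivity), abs_mul,
            abs_of_nonneg (by positivity)]
          gcongr
      _ ≤ _ := by
          have hk := hf.k_pos
          nlinarith [mul_nonneg hk.le (sq_nonneg (1 - v t - w t)), sq_nonneg (1 - v t - w t),
            mul_nonneg (abs_nonneg c) (sq_nonneg (1 - v t))]
  have hv0 : v = fun _ => 1 := funext fun t => by
    nlinarith [hN t, sq_nonneg (1 - v t), sq_nonneg (w t)]
  have := h.tendsto_atBot
  rw [hv0] at this
  exact one_ne_zero (tendsto_nhds_unique tendsto_const_nhds this)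

/-- A zero of `w` is a minimum, so `f (v z) = 0` and `v z ≤ α`. To its left `f v ≤ 0` and `c ≥ 0`
make `w` nondecreasing, so `w = 0` there and `v` is a positive constant, against `v → 0`. -/
lemma flux_pos (h : IsPhaseFront γ c f v w) (hf : IsSignedReaction f α k) (z : ℝ) :
    0 < w z := by
  refine (h.nonneg z).lt_of_ne' fun h0 => ?_
  have hmin : IsLocalMin w z := Eventually.of_forall fun t => h0 ▸ h.nonneg t
  have h1 := hmin.hasDerivAt_eq_zero (h.hasDerivAt_snd z)
  rw [h0, velocity_zero, mul_zero, zero_sub, neg_eq_zero] at h1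
  have hα : v z ≤ α := by
    by_contra! hlt
    exact (hf.pos _ ⟨hlt, h.fst_lt_one hf z⟩).ne' h1
  have hm : MonotoneOn w (Iic z) := by
    apply monotoneOn_of_hasDerivWithinAt_nonneg (convex_Iic z)
      (fun t _ => (h.hasDerivAt_snd t).continuousAt.continuousWithinAt)
      (fun t _ => (h.hasDerivAt_snd t).hasDerivWithinAt)
    intro t ht
    have ht' : t ∈ Iic z := interior_subset ht
    have h2 := hf.nonpos (v t) ⟨(h.mem_Icc t).1, (h.monotone ht').trans hα⟩
    have h3 := mul_nonneg (h.speed_nonneg hf) (velocity_nonneg (γ := γ) (h.nonneg t))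
    linarith
  have hw : ∀ t ≤ z, w t = 0 := fun t ht =>
    le_antisymm (h0 ▸ hm ht self_mem_Iic ht) (h.nonneg t)
  have hv : AntitoneOn v (Iic z) := by
    apply antitoneOn_of_hasDerivWithinAt_nonpos (convex_Iic z) h.continuous_fst.continuousOn
      (fun t _ => (h.hasDerivAt_fst t).hasDerivWithinAt)
    intro t ht
    have ht' : t ∈ Iic z := interior_subset ht
    rw [hw t ht', velocity_zero]
  have h4 : ∀ᶠ t in atBot, v z ≤ v t := by
    filter_upwards [eventually_le_atBot z] with t ht
    exact hv ht self_mem_Iic ht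
  exact absurd (ge_of_tendsto h.tendsto_atBot h4) (not_le.2 (h.fst_pos hf z))

/-- The energy of a front is the solution of the energy equation. -/
lemma energy_eq (h : IsPhaseFront γ c f v w) (hf : IsSignedReaction f α k) (z : ℝ) :
    energy γ (w z) = energyProfile γ c f (v z) := by
  have hc := h.speed_nonneg hf
  have hY := fun z => (hf.hasDerivAt_energyProfile (γ := γ) hc (h.mem_Icc z))
  -- The squared discrepancy has derivative `2 c v'` times the product of the differences of
  -- energies and of slopes. This is nonnegative by monotonicity, and the discrepancy tends to `0`
  -- at `+∞`.
  have hd : ∀ z, HasDerivAt (fun z => (energy γ (w z) - energyProfile γ c f (v z)) ^ 2)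
      (2 * (energy γ (w z) - energyProfile γ c f (v z)) * (c * velocity γ (w z) *
        (slope γ (energy γ (w z)) - slope γ (energyProfile γ c f (v z))))) z := fun z => by
    have h1 := (((hasDerivAt_energy γ (w z)).comp z (h.hasDerivAt_snd z)).sub
      ((hY z).comp z (h.hasDerivAt_fst z))).pow 2
    refine h1.congr_deriv ?_
    rw [slope_energy (h.nonneg z)]
    simp only [Nat.cast_ofNat, Nat.add_one_sub_one, pow_one, Pi.sub_apply, Function.comp]
    ring
  have hm : Monotone fun z => (energy γ (w z) - energyProfile γ c f (v z)) ^ 2 :=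
    monotone_of_hasDerivAt_nonneg hd fun z => by
      have h1 := mul_nonneg hc (velocity_nonneg (γ := γ) (h.nonneg z))
      have h2 : 0 ≤ (energy γ (w z) - energyProfile γ c f (v z)) *
          (slope γ (energy γ (w z)) - slope γ (energyProfile γ c f (v z))) := by
        rcases le_total (energy γ (w z)) (energyProfile γ c f (v z)) with h3 | h3
        · exact mul_nonneg_of_nonpos_of_nonpos (sub_nonpos.2 h3)
            (sub_nonpos.2 (slope_mono γ h3))
        · exact mul_nonneg (sub_nonneg.2 h3) (sub_nonneg.2 (slope_mono γ h3))
      change (0 : ℝ) ≤ _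
      nlinarith [mul_nonneg h1 h2]
  have hlim : Tendsto (fun z => (energy γ (w z) - energyProfile γ c f (v z)) ^ 2) atTop
      (𝓝 ((energy γ 0 - energyProfile γ c f 1) ^ 2)) :=
    ((((continuous_energy γ).tendsto 0).comp (h.tendsto_flux_atTop hf)).sub
      ((hf.hasDerivAt_energyProfile hc (by norm_num)).continuousAt.tendsto.comp
        h.tendsto_atTop)).pow 2
  rw [energy_zero, hf.energyProfile_one hc, sub_zero, zero_pow two_ne_zero] at hlim
  have h1 := hm.ge_of_tendsto hlim z
  have h2 := pow_eq_zero_iff (two_ne_zero) |>.1 (le_antisymm h1 (sq_nonneg _))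
  exact sub_eq_zero.1 h2

lemma hasFrontEnergy (h : IsPhaseFront γ c f v w) (hf : IsSignedReaction f α k) :
    HasFrontEnergy γ c f := by
  have hc := h.speed_nonneg hf
  refine ⟨hc, ?_, fun s hs => ?_⟩
  · have h1 := ((continuous_energy γ).tendsto 0).comp (h.tendsto_flux_atBot hf)
    have h2 := (hf.hasDerivAt_energyProfile (γ := γ) hc
      (left_mem_Icc.2 zero_le_one)).continuousAt.tendsto.comp h.tendsto_atBot
    rw [energy_zero] at h1
    refine tendsto_nhds_unique h2 (h1.congr fun z => ?_)
    exact h.energy_eq hf z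
  · obtain ⟨a, ha⟩ := (h.tendsto_atBot.eventually_lt_const hs.1).exists
    obtain ⟨b, hb⟩ := (h.tendsto_atTop.eventually_const_lt hs.2).exists
    obtain ⟨z, rfl⟩ := mem_range_of_exists_le_of_exists_ge h.continuous_fst ⟨a, ha.le⟩ ⟨b, hb.le⟩
    rw [← h.energy_eq hf]
    have := h.flux_pos hf z
    rw [energy]; positivity

lemma hasDerivAt_slope (h : IsPhaseFront γ c f v w) (hf : IsSignedReaction f α k) (z : ℝ) :
    HasDerivAt v (slope γ (energyProfile γ c f (v z))) z := by
  rw [← h.energy_eq hf, slope_energy (h.nonneg z)]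
  exact h.hasDerivAt_fst z

lemma deriv_eq (h : IsPhaseFront γ c f v w) : deriv v = fun z => velocity γ (w z) :=
  funext fun z => (h.hasDerivAt_fst z).deriv

lemma deriv_deriv_eq (h : IsPhaseFront γ c f v w) : deriv (deriv v) =
    fun z => 1 / √(1 + γ ^ 2 * w z ^ 2) ^ 3 * (c * velocity γ (w z) - f (v z)) := by
  rw [h.deriv_eq]
  exact funext fun z => ((hasDerivAt_velocity γ (w z)).comp z (h.hasDerivAt_snd z)).deriv

lemma isFront (h : IsPhaseFront γ c f v w) (hf : Continuous f) : IsFront γ c f v := by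
  have hw : Continuous w := continuous_iff_continuousAt.2 fun z =>
    (h.hasDerivAt_snd z).continuousAt
  refine ⟨⟨?_, h.monotone, h.tendsto_atBot, h.tendsto_atTop⟩, fun z => ?_, fun z => ?_⟩
  · have h1 : ContDiff ℝ (1 + 1) v := by
      refine contDiff_succ_iff_deriv.2 ⟨fun z => (h.hasDerivAt_fst z).differentiableAt,
        by simp, contDiff_one_iff_deriv.2 ⟨?_, ?_⟩⟩
      · rw [h.deriv_eq]
        exact fun z => ((hasDerivAt_velocity γ (w z)).comp z
          (h.hasDerivAt_snd z)).differentiableAt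
      · rw [h.deriv_deriv_eq]
        refine Continuous.mul (Continuous.div continuous_const (by fun_prop) fun z => ?_)
          ((((continuous_velocity γ).comp hw).const_mul c).sub (hf.comp h.continuous_fst))
        exact (pow_pos (sqrt_one_add_sq_pos γ (w z)) 3).ne'
    simpa [one_add_one_eq_two] using h1
  · rw [h.deriv_eq]
    have h1 := one_sub_velocity_sq γ (w z)
    have h2 : 0 < 1 / (1 + γ ^ 2 * w z ^ 2) := one_div_pos.2 (one_add_sq_pos γ (w z))
    simp only
    linarith
  · simp only [h.deriv_eq, flux_velocity]
    rw [(h.hasDerivAt_snd z).deriv]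
    ring

end IsPhaseFront

end BornInfeld

/-! ### The scalar flow `v' = P(v)` on `(0, 1)` and its dependence on `P`. -/

namespace BornInfeld

/-- The time needed by the flow of `P` to go from `a` to `s`. -/
noncomputable def timeMap (P : ℝ → ℝ) (a s : ℝ) : ℝ := ∫ r in a..s, 1 / P r

/-- The solution on the line of `v' = P(v)`, `v(0) = a`, with values in `(0, 1)`. -/
noncomputable def flow (P : ℝ → ℝ) (a : ℝ) : ℝ → ℝ := Function.invFunOn (timeMap P a) (Ioo 0 1)

/-- A speed law on `(0, 1)` for which `0` and `1` are reached in infinite time only. -/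
structure IsSpeedLaw (P : ℝ → ℝ) (C : ℝ) : Prop where
  continuousOn : ContinuousOn P (Ioo 0 1)
  pos : ∀ s ∈ Ioo (0 : ℝ) 1, 0 < P s
  le_left : ∀ s ∈ Ioo (0 : ℝ) 1, P s ≤ C * s
  le_right : ∀ s ∈ Ioo (0 : ℝ) 1, P s ≤ C * (1 - s)

lemma uIcc_subset_Ioo {a s : ℝ} (ha : a ∈ Ioo (0 : ℝ) 1) (hs : s ∈ Ioo (0 : ℝ) 1) :
    uIcc a s ⊆ Ioo 0 1 := ordConnected_Ioo.uIcc_subset ha hs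

namespace IsSpeedLaw

variable {P : ℝ → ℝ} {C a s z : ℝ}

lemma C_pos (hP : IsSpeedLaw P C) : 0 < C := by
  have h1 := hP.pos (1 / 2) (by norm_num)
  have h2 := hP.le_left (1 / 2) (by norm_num)
  linarith

lemma continuousOn_inv (hP : IsSpeedLaw P C) : ContinuousOn (fun s => 1 / P s) (Ioo 0 1) :=
  continuousOn_const.div hP.continuousOn fun s hs => (hP.pos s hs).ne'

lemma hasDerivAt_timeMap (hP : IsSpeedLaw P C) (ha : a ∈ Ioo (0 : ℝ) 1)
    (hs : s ∈ Ioo (0 : ℝ) 1) : HasDerivAt (timeMap P a) (1 / P s) s := by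
  refine intervalIntegral.integral_hasDerivAt_right
    (hP.continuousOn_inv.mono (uIcc_subset_Ioo ha hs)).intervalIntegrable ?_
    (hP.continuousOn_inv.continuousAt (isOpen_Ioo.mem_nhds hs))
  exact hP.continuousOn_inv.stronglyMeasurableAtFilter isOpen_Ioo s hs

lemma timeMap_self : timeMap P a a = 0 := intervalIntegral.integral_same

lemma strictMonoOn_timeMap (hP : IsSpeedLaw P C) (ha : a ∈ Ioo (0 : ℝ) 1) :
    StrictMonoOn (timeMap P a) (Ioo 0 1) := by
  apply strictMonoOn_of_deriv_pos (convex_Ioo 0 1)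
  · exact fun s hs => (hP.hasDerivAt_timeMap ha hs).continuousAt.continuousWithinAt
  · intro s hs
    have hs' : s ∈ Ioo (0 : ℝ) 1 := interior_subset hs
    rw [(hP.hasDerivAt_timeMap ha hs').deriv]
    exact one_div_pos.2 (hP.pos s hs')

/-- `1/P ≥ 1/(C(1 - s))`, whose integral diverges logarithmically at `1`. -/
lemma exists_timeMap_ge (hP : IsSpeedLaw P C) (ha : a ∈ Ioo (0 : ℝ) 1) (z : ℝ) :
    ∃ s ∈ Ioo (0 : ℝ) 1, z ≤ timeMap P a s := by
  have hC := hP.C_pos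
  have hm : MonotoneOn (fun s => timeMap P a s + Real.log (1 - s) / C) (Ioo 0 1) := by
    have hd : ∀ s ∈ Ioo (0 : ℝ) 1, HasDerivAt (fun s => timeMap P a s + Real.log (1 - s) / C)
        (1 / P s + (-1 / (1 - s)) / C) s := fun s hs =>
      (hP.hasDerivAt_timeMap ha hs).add
        ((((hasDerivAt_id s).const_sub 1).log (sub_pos.2 hs.2).ne').div_const C)
    apply monotoneOn_of_hasDerivWithinAt_nonneg (convex_Ioo 0 1)
      (fun s hs => (hd s hs).continuousAt.continuousWithinAt)
      (fun s hs => (hd s (interior_subset hs)).hasDerivWithinAt)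
    intro s hs
    have hs' : s ∈ Ioo (0 : ℝ) 1 := interior_subset hs
    have h1 := one_div_le_one_div_of_le (hP.pos s hs') (hP.le_right s hs')
    have h2 : 0 < 1 - s := sub_pos.2 hs'.2
    have h3 : -1 / (1 - s) / C = -(1 / (C * (1 - s))) := by field_simp
    linarith
  have hlim : Tendsto (fun s : ℝ => Real.log (1 - a) / C - Real.log (1 - s) / C) (𝓝[<] 1)
      atTop := by
    have h1 : Tendsto (fun s : ℝ => 1 - s) (𝓝[<] 1) (𝓝[>] 0) := by
      refine tendsto_nhdsWithin_iff.2 ⟨?_, ?_⟩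
      · have : Continuous fun s : ℝ => 1 - s := by fun_prop
        simpa using (this.tendsto 1).mono_left nhdsWithin_le_nhds
      · filter_upwards [self_mem_nhdsWithin] with s hs
        exact mem_Ioi.2 (sub_pos.2 (mem_Iio.1 hs))
    have h2 := (Real.tendsto_log_nhdsGT_zero.comp h1).atBot_div_const hC
    exact tendsto_atTop_add_const_left _ _ (tendsto_neg_atBot_atTop.comp h2)
  obtain ⟨s, hs1, hs2⟩ := ((hlim.eventually_ge_atTop z).and (Ioo_mem_nhdsLT ha.2)).exists
  have hs : s ∈ Ioo (0 : ℝ) 1 := ⟨ha.1.trans hs2.1, hs2.2⟩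
  refine ⟨s, hs, ?_⟩
  have := hm ha hs hs2.1.le
  simp only [timeMap_self] at this
  linarith

lemma exists_timeMap_le (hP : IsSpeedLaw P C) (ha : a ∈ Ioo (0 : ℝ) 1) (z : ℝ) :
    ∃ s ∈ Ioo (0 : ℝ) 1, timeMap P a s ≤ z := by
  have hC := hP.C_pos
  have hm : MonotoneOn (fun s => timeMap P a s - Real.log s / C) (Ioo 0 1) := by
    have hd : ∀ s ∈ Ioo (0 : ℝ) 1, HasDerivAt (fun s => timeMap P a s - Real.log s / C)
        (1 / P s - s⁻¹ / C) s := fun s hs =>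
      (hP.hasDerivAt_timeMap ha hs).sub ((Real.hasDerivAt_log hs.1.ne').div_const C)
    apply monotoneOn_of_hasDerivWithinAt_nonneg (convex_Ioo 0 1)
      (fun s hs => (hd s hs).continuousAt.continuousWithinAt)
      (fun s hs => (hd s (interior_subset hs)).hasDerivWithinAt)
    intro s hs
    have hs' : s ∈ Ioo (0 : ℝ) 1 := interior_subset hs
    have h1 := one_div_le_one_div_of_le (hP.pos s hs') (hP.le_left s hs')
    have h2 : 0 < s := hs'.1
    have h3 : s⁻¹ / C = 1 / (C * s) := by field_simp
    linarith
  have hlim : Tendsto (fun s : ℝ => Real.log s / C - Real.log a / C) (𝓝[>] 0) atBot :=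
    tendsto_atBot_add_const_right _ _ (Real.tendsto_log_nhdsGT_zero.atBot_div_const hC)
  obtain ⟨s, hs1, hs2⟩ := ((hlim.eventually_le_atBot z).and (Ioo_mem_nhdsGT ha.1)).exists
  have hs : s ∈ Ioo (0 : ℝ) 1 := ⟨hs2.1, hs2.2.trans ha.2⟩
  refine ⟨s, hs, ?_⟩
  have := hm hs ha hs2.2.le
  simp only [timeMap_self] at this
  linarith

lemma surjOn_timeMap (hP : IsSpeedLaw P C) (ha : a ∈ Ioo (0 : ℝ) 1) :
    SurjOn (timeMap P a) (Ioo 0 1) univ := by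
  intro z _
  obtain ⟨s₁, hs₁, h₁⟩ := hP.exists_timeMap_le ha z
  obtain ⟨s₂, hs₂, h₂⟩ := hP.exists_timeMap_ge ha z
  exact isPreconnected_Ioo.intermediate_value hs₁ hs₂
    (fun s hs => (hP.hasDerivAt_timeMap ha hs).continuousAt.continuousWithinAt) ⟨h₁, h₂⟩

lemma flow_mem (hP : IsSpeedLaw P C) (ha : a ∈ Ioo (0 : ℝ) 1) (z : ℝ) :
    flow P a z ∈ Ioo (0 : ℝ) 1 :=
  Function.invFunOn_mem (hP.surjOn_timeMap ha (mem_univ z))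

lemma timeMap_flow (hP : IsSpeedLaw P C) (ha : a ∈ Ioo (0 : ℝ) 1) (z : ℝ) :
    timeMap P a (flow P a z) = z :=
  Function.invFunOn_eq (hP.surjOn_timeMap ha (mem_univ z))

lemma flow_timeMap (hP : IsSpeedLaw P C) (ha : a ∈ Ioo (0 : ℝ) 1) (hs : s ∈ Ioo (0 : ℝ) 1) :
    flow P a (timeMap P a s) = s :=
  (hP.strictMonoOn_timeMap ha).injOn (hP.flow_mem ha _) hs (hP.timeMap_flow ha _)

lemma flow_zero (hP : IsSpeedLaw P C) (ha : a ∈ Ioo (0 : ℝ) 1) : flow P a 0 = a := by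
  simpa [timeMap_self] using hP.flow_timeMap ha ha

lemma lt_flow_iff (hP : IsSpeedLaw P C) (ha : a ∈ Ioo (0 : ℝ) 1) (hs : s ∈ Ioo (0 : ℝ) 1) :
    s < flow P a z ↔ timeMap P a s < z := by
  rw [← (hP.strictMonoOn_timeMap ha).lt_iff_lt hs (hP.flow_mem ha z), hP.timeMap_flow ha]

lemma flow_lt_iff (hP : IsSpeedLaw P C) (ha : a ∈ Ioo (0 : ℝ) 1) (hs : s ∈ Ioo (0 : ℝ) 1) :
    flow P a z < s ↔ z < timeMap P a s := by
  rw [← (hP.strictMonoOn_timeMap ha).lt_iff_lt (hP.flow_mem ha z) hs, hP.timeMap_flow ha]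

lemma strictMono_flow (hP : IsSpeedLaw P C) (ha : a ∈ Ioo (0 : ℝ) 1) :
    StrictMono (flow P a) := fun x y h => by
  rwa [hP.lt_flow_iff ha (hP.flow_mem ha x), hP.timeMap_flow ha]

lemma hasDerivAt_flow (hP : IsSpeedLaw P C) (ha : a ∈ Ioo (0 : ℝ) 1) (z : ℝ) :
    HasDerivAt (flow P a) (P (flow P a z)) z := by
  have hmem := hP.flow_mem ha z
  have hcont : ContinuousAt (flow P a) z := by
    refine ((hP.strictMono_flow ha).strictMonoOn univ).continuousAt_of_image_mem_nhds
      univ_mem ?_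
    refine mem_of_superset (isOpen_Ioo.mem_nhds hmem) fun s hs => ?_
    exact ⟨_, mem_univ _, hP.flow_timeMap ha hs⟩
  have := HasDerivAt.of_local_left_inverse hcont (hP.hasDerivAt_timeMap ha hmem)
    (one_div_pos.2 (hP.pos _ hmem)).ne' (Eventually.of_forall (hP.timeMap_flow ha))
  simpa using this

lemma tendsto_flow_atTop (hP : IsSpeedLaw P C) (ha : a ∈ Ioo (0 : ℝ) 1) :
    Tendsto (flow P a) atTop (𝓝 1) := by
  refine tendsto_order.2 ⟨fun b hb => ?_, fun b hb => Eventually.of_forall fun z =>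
    (hP.flow_mem ha z).2.trans hb⟩
  have hs : max b a ∈ Ioo (0 : ℝ) 1 := ⟨ha.1.trans_le (le_max_right _ _), max_lt hb ha.2⟩
  filter_upwards [eventually_gt_atTop (timeMap P a (max b a))] with z hz
  exact (le_max_left b a).trans_lt ((hP.lt_flow_iff ha hs).2 hz)

lemma tendsto_flow_atBot (hP : IsSpeedLaw P C) (ha : a ∈ Ioo (0 : ℝ) 1) :
    Tendsto (flow P a) atBot (𝓝 0) := by
  refine tendsto_order.2 ⟨fun b hb => Eventually.of_forall fun z =>
    hb.trans (hP.flow_mem ha z).1, fun b hb => ?_⟩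
  have hs : min b a ∈ Ioo (0 : ℝ) 1 := ⟨lt_min hb ha.1, (min_le_right _ _).trans_lt ha.2⟩
  filter_upwards [eventually_lt_atBot (timeMap P a (min b a))] with z hz
  exact ((hP.flow_lt_iff ha hs).2 hz).trans_le (min_le_left _ _)

/-- Uniqueness for `v' = P(v)`. -/
lemma eq_flow (hP : IsSpeedLaw P C) {v : ℝ → ℝ} (hv : ∀ z, v z ∈ Ioo (0 : ℝ) 1)
    (hd : ∀ z, HasDerivAt v (P (v z)) z) : v = flow P (v 0) := by
  have ha := hv 0
  have h1 : ∀ z, HasDerivAt (fun z => timeMap P (v 0) (v z) - z) 0 z := fun z => by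
    have h2 := ((hP.hasDerivAt_timeMap ha (hv z)).comp z (hd z)).sub (hasDerivAt_id z)
    refine h2.congr_deriv ?_
    have := (hP.pos _ (hv z)).ne'
    field_simp
    norm_num
  funext z
  have h3 := is_const_of_deriv_eq_zero (fun z => (h1 z).differentiableAt)
    (fun z => (h1 z).deriv) z 0
  simp only [timeMap_self, sub_zero] at h3
  rw [← sub_eq_zero.1 h3, hP.flow_timeMap ha (hv z), sub_eq_zero.1 h3]

end IsSpeedLaw

variable {P : ℝ → ℝ → ℝ} {P₀ : ℝ → ℝ} {C : ℝ → ℝ} {C₀ a : ℝ} {l : Filter ℝ}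

/-- On the compact interval between `a` and `s` the limit law has a positive minimum, and half of it
eventually bounds `P γ` from below. This dominates the integrands. -/
lemma tendsto_timeMap [l.IsCountablyGenerated] (hP : ∀ᶠ γ in l, IsSpeedLaw (P γ) (C γ))
    (hP₀ : IsSpeedLaw P₀ C₀)
    (hU : TendstoUniformlyOn P P₀ l (Icc 0 1)) (ha : a ∈ Ioo (0 : ℝ) 1) {s : ℝ}
    (hs : s ∈ Ioo (0 : ℝ) 1) :
    Tendsto (fun γ => timeMap (P γ) a s) l (𝓝 (timeMap P₀ a s)) := by
  have hsub := uIcc_subset_Ioo ha hs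
  obtain ⟨r, hr, hmin⟩ := isCompact_uIcc.exists_isMinOn nonempty_uIcc
    (hP₀.continuousOn.mono hsub)
  have hδ : 0 < P₀ r := hP₀.pos r (hsub hr)
  apply intervalIntegral.tendsto_integral_filter_of_dominated_convergence
    (fun _ => 1 / (P₀ r / 2))
  · filter_upwards [hP] with γ h
    exact ((h.continuousOn_inv.mono hsub).mono uIoc_subset_uIcc).aestronglyMeasurable
      measurableSet_uIoc
  · filter_upwards [hP, (Metric.tendstoUniformlyOn_iff.1 hU) _ (half_pos hδ)] with γ h h2
    refine Eventually.of_forall fun t ht => ?_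
    have ht' := uIoc_subset_uIcc ht
    have h3 := h2 t (Ioo_subset_Icc_self (hsub ht'))
    rw [Real.dist_eq] at h3
    have h4 := le_of_abs_le h3.le
    have h5 : P₀ r ≤ P₀ t := hmin ht'
    have h6 := h.pos t (hsub ht')
    rw [Real.norm_eq_abs, abs_of_pos (one_div_pos.2 h6)]
    exact one_div_le_one_div_of_le (half_pos hδ) (by linarith)
  · exact intervalIntegrable_const
  · refine Eventually.of_forall fun t ht => ?_
    have ht' := hsub (uIoc_subset_uIcc ht)
    exact tendsto_const_nhds.div (hU.tendsto_at (Ioo_subset_Icc_self ht')) (hP₀.pos t ht').ne'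

/-- Comparing the flow with a level `b` is the same as comparing the time map at `b` with `z`, so
convergence of time maps passes to their inverses. -/
lemma tendsto_flow [l.IsCountablyGenerated] (hP : ∀ᶠ γ in l, IsSpeedLaw (P γ) (C γ))
    (hP₀ : IsSpeedLaw P₀ C₀)
    (hU : TendstoUniformlyOn P P₀ l (Icc 0 1)) (ha : a ∈ Ioo (0 : ℝ) 1) (z : ℝ) :
    Tendsto (fun γ => flow (P γ) a z) l (𝓝 (flow P₀ a z)) := by
  have hmem := hP₀.flow_mem ha z
  refine tendsto_order.2 ⟨fun b hb => ?_, fun b hb => ?_⟩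
  · rcases le_or_gt b 0 with hb0 | hb0
    · filter_upwards [hP] with γ h
      exact hb0.trans_lt (h.flow_mem ha z).1
    · have hb1 : b ∈ Ioo (0 : ℝ) 1 := ⟨hb0, hb.trans hmem.2⟩
      filter_upwards [hP, (tendsto_timeMap hP hP₀ hU ha hb1).eventually_lt_const
        ((hP₀.lt_flow_iff ha hb1).1 hb)] with γ h h2
      exact (h.lt_flow_iff ha hb1).2 h2
  · rcases le_or_gt 1 b with hb0 | hb0
    · filter_upwards [hP] with γ h
      exact (h.flow_mem ha z).2.trans_le hb0
    · have hb1 : b ∈ Ioo (0 : ℝ) 1 := ⟨hmem.1.trans hb, hb0⟩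
      filter_upwards [hP, (tendsto_timeMap hP hP₀ hU ha hb1).eventually_const_lt
        ((hP₀.flow_lt_iff ha hb1).1 hb)] with γ h h2
      exact (h.flow_lt_iff ha hb1).2 h2

/-- Pointwise convergence of monotone functions with values in `(0, 1)` to a strictly monotone
bijection onto `(0, 1)` is uniform. -/
lemma tendstoUniformly_of_monotone {F : ℝ → ℝ → ℝ} {F₀ : ℝ → ℝ}
    (hF : ∀ᶠ γ in l, Monotone (F γ) ∧ ∀ z, F γ z ∈ Ioo (0 : ℝ) 1) (hF₀ : StrictMono F₀)
    (hr : range F₀ = Ioo 0 1) (hlim : ∀ z, Tendsto (fun γ => F γ z) l (𝓝 (F₀ z))) :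
    TendstoUniformly F F₀ l := by
  rw [Metric.tendstoUniformly_iff]
  intro ε hε
  obtain ⟨n, hn⟩ := exists_nat_one_div_lt (half_pos hε)
  have hn0 : (0 : ℝ) < n + 1 := by positivity
  -- Points where `F₀` takes the levels `j/(n+1)`, `0 < j < n + 1`; control at these finitely many
  -- points suffices. Other `j` get the irrelevant value `0`.
  have hz : ∀ j : ℕ, ∃ z, 0 < j → j < n + 1 → F₀ z = j / (n + 1) := by
    intro j
    by_cases hj : 0 < j ∧ j < n + 1
    · have : (j : ℝ) / (n + 1) ∈ range F₀ := by
        rw [hr]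
        refine ⟨div_pos (by exact_mod_cast hj.1) hn0, (div_lt_one hn0).2 ?_⟩
        exact_mod_cast hj.2
      obtain ⟨z, hz⟩ := this
      exact ⟨z, fun _ _ => hz⟩
    · exact ⟨0, fun h1 h2 => absurd ⟨h1, h2⟩ hj⟩
  choose x hx using hz
  have hev : ∀ᶠ γ in l, ∀ j ∈ Finset.range (n + 1), |F γ (x j) - F₀ (x j)| < ε / 2 := by
    rw [eventually_all_finset]
    intro j _
    have := (Metric.tendsto_nhds.1 (hlim (x j))) _ (half_pos hε)
    simpa [Real.dist_eq] using this
  filter_upwards [hF, hev] with γ hγ h z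
  have hmem : F₀ z ∈ Ioo (0 : ℝ) 1 := hr ▸ mem_range_self z
  -- `F₀ z` lies between levels `j` and `j + 1`, and monotonicity traps `F γ z` between the values
  -- at the two grid points. In the extreme cells the missing grid point is replaced by the bounds
  -- `0` and `1`.
  set j := ⌊F₀ z * (n + 1)⌋₊ with hj_def
  have hj1 : (j : ℝ) ≤ F₀ z * (n + 1) := Nat.floor_le (mul_nonneg hmem.1.le hn0.le)
  have hj2 : F₀ z * (n + 1) < j + 1 := Nat.lt_floor_add_one _
  have hj3 : j < n + 1 := by
    have : (j : ℝ) < n + 1 := hj1.trans_lt (mul_lt_of_lt_one_left hn0 hmem.2)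
    exact_mod_cast this
  rw [Real.dist_eq, abs_lt]
  constructor
  · rcases Nat.lt_or_ge (j + 1) (n + 1) with hlt | hge
    · have h1 := hx (j + 1) (Nat.succ_pos j) hlt
      have h2 : z ≤ x (j + 1) := by
        rw [← hF₀.le_iff_le, h1, le_div_iff₀ hn0]
        push_cast; exact hj2.le
      have h3 := hγ.1 h2
      have h4 := (abs_lt.1 (h (j + 1) (Finset.mem_range.2 hlt))).2
      have h5 : F₀ (x (j + 1)) ≤ F₀ z + 1 / (n + 1) := by
        rw [h1, div_le_iff₀ hn0, add_mul, one_div_mul_cancel hn0.ne']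
        push_cast; linarith
      linarith
    · have h1 := (hγ.2 z).2
      have h2 : (n : ℝ) ≤ j := by exact_mod_cast Nat.succ_le_succ_iff.1 hge
      have h3 : 1 ≤ F₀ z + 1 / (n + 1) := by
        have : (1 : ℝ) * (n + 1) ≤ (F₀ z + 1 / (n + 1)) * (n + 1) := by
          rw [add_mul, one_div_mul_cancel hn0.ne']; linarith
        exact le_of_mul_le_mul_right this hn0
      linarith
  · rcases Nat.eq_zero_or_pos j with h0 | h0
    · have h1 := (hγ.2 z).1
      rw [h0, Nat.cast_zero, zero_add, ← lt_div_iff₀ hn0] at hj2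
      linarith
    · have h1 := hx j h0 hj3
      have h2 : x j ≤ z := by
        rw [← hF₀.le_iff_le, h1, div_le_iff₀ hn0]; exact hj1
      have h3 := hγ.1 h2
      have h4 := (abs_lt.1 (h j (Finset.mem_range.2 hj3))).1
      have h5 : F₀ z ≤ F₀ (x j) + 1 / (n + 1) := by
        rw [h1, ← add_div, le_div_iff₀ hn0]; exact hj2.le
      linarith

/-- The flow depends continuously, uniformly on the line, on the speed law. -/
lemma tendstoUniformly_flow [l.IsCountablyGenerated] (hP : ∀ᶠ γ in l, IsSpeedLaw (P γ) (C γ))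
    (hP₀ : IsSpeedLaw P₀ C₀) (hU : TendstoUniformlyOn P P₀ l (Icc 0 1))
    (ha : a ∈ Ioo (0 : ℝ) 1) :
    TendstoUniformly (fun γ => flow (P γ) a) (flow P₀ a) l := by
  refine tendstoUniformly_of_monotone ?_ (hP₀.strictMono_flow ha) ?_ (tendsto_flow hP hP₀ hU ha)
  · filter_upwards [hP] with γ h
    exact ⟨(h.strictMono_flow ha).monotone, h.flow_mem ha⟩
  · exact Subset.antisymm (range_subset_iff.2 (hP₀.flow_mem ha)) fun s hs =>
      ⟨_, hP₀.flow_timeMap ha hs⟩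

/-- Uniform convergence of compositions through the compact interval `[0, 1]`. -/
lemma tendstoUniformly_comp_of_Icc {G F : ℝ → ℝ → ℝ} {G₀ F₀ : ℝ → ℝ}
    (hG : TendstoUniformlyOn G G₀ l (Icc 0 1)) (hG₀ : ContinuousOn G₀ (Icc 0 1))
    (hF : TendstoUniformly F F₀ l) (hmem : ∀ᶠ γ in l, ∀ z, F γ z ∈ Icc (0 : ℝ) 1)
    (hmem₀ : ∀ z, F₀ z ∈ Icc (0 : ℝ) 1) :
    TendstoUniformly (fun γ z => G γ (F γ z)) (fun z => G₀ (F₀ z)) l := by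
  have hu := isCompact_Icc.uniformContinuousOn_of_continuous hG₀
  rw [Metric.tendstoUniformly_iff]
  intro ε hε
  obtain ⟨δ, hδ, hd⟩ := Metric.uniformContinuousOn_iff.1 hu _ (half_pos hε)
  filter_upwards [Metric.tendstoUniformlyOn_iff.1 hG _ (half_pos hε),
    Metric.tendstoUniformly_iff.1 hF δ hδ, hmem] with γ h1 h2 h3 z
  calc _ ≤ dist (G₀ (F₀ z)) (G₀ (F γ z)) + dist (G₀ (F γ z)) (G γ (F γ z)) :=
        dist_triangle _ _ _
    _ < ε / 2 + ε / 2 := add_lt_add (hd _ (hmem₀ z) _ (h3 z) (h2 z)) (h1 _ (h3 z))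
    _ = ε := add_halves ε

end BornInfeld

/-! ### Critical profiles and their `C²` convergence. -/

namespace BornInfeld

/-- The derivative of a front of speed `c` as a function of its value. -/
noncomputable def speedLaw (γ c : ℝ) (f : ℝ → ℝ) (s : ℝ) : ℝ := slope γ (energyProfile γ c f s)

/-- The front profile of least speed with value `a` at `0`. -/
noncomputable def criticalProfile (γ : ℝ) (f : ℝ → ℝ) (a : ℝ) : ℝ → ℝ :=
  flow (speedLaw γ (minimalSpeed γ f) f) a

/-- A uniformly convergent family remains so after composition with a continuous map, if the limit
takes values in a compact set. -/
lemma tendstoUniformlyOn_continuous_comp {ι β E : Type*} [UniformSpace E] {l : Filter ι}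
    {F : ι → β → E} {F₀ : β → E} {S : Set β} {K : Set E} {G : E → ℝ} (hG : Continuous G)
    (hK : IsCompact K) (hF : TendstoUniformlyOn F F₀ l S) (hm : MapsTo F₀ S K) :
    TendstoUniformlyOn (fun i s => G (F i s)) (fun s => G (F₀ s)) l S := by
  intro r hr
  filter_upwards [hF _ (hK.uniformContinuousAt_of_continuousAt G
    (fun _ _ => hG.continuousAt) hr)] with i hi s hs
  exact hi s hs (hm hs)

lemma tendstoUniformlyOn_prodMk {ι β E E' : Type*} [UniformSpace E] [UniformSpace E']
    {l : Filter ι} {F : ι → β → E} {F₀ : β → E} {G : ι → β → E'} {G₀ : β → E'} {S : Set β}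
    (hF : TendstoUniformlyOn F F₀ l S) (hG : TendstoUniformlyOn G G₀ l S) :
    TendstoUniformlyOn (fun i s => (F i s, G i s)) (fun s => (F₀ s, G₀ s)) l S :=
  fun r hr => (hF.prodMk hG r hr).diag_of_prod

lemma continuous_slope_uncurry : Continuous fun p : ℝ × ℝ => slope p.1 p.2 := by
  unfold slope momentum
  refine Continuous.div (by fun_prop) (by fun_prop) fun p => ?_
  have : 0 ≤ max p.2 0 := le_max_right _ _
  positivity

namespace IsSignedReaction

variable {f g v : ℝ → ℝ} {α k γ c a : ℝ}

/-- Unlike `momentum_le_mul`, this allows negative `f`. Where `q` exceeds the line, the summand `1`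
in its slope gives `q ≥ s`, so `slope ≥ s / (1 + γ²k)`. Hence `-f / slope ≤ k(1 + γ²k)`, and `q`
grows more slowly than the line. -/
lemma momentum_energyProfile_le (hf : IsSignedReaction f α k) (h : HasFrontEnergy γ c f) :
    ∀ s ∈ Icc (0 : ℝ) 1,
      momentum γ (energyProfile γ c f s) ≤ (1 + c + k * (1 + γ ^ 2 * k)) * s := by
  have hk := hf.k_pos
  have hc := h.speed_nonneg
  intro s hs
  have := nonpos_of_deriv_nonpos_of_pos (a := 0) (b := 1)
    (D := fun s => momentum γ (energyProfile γ c f s) - (1 + c + k * (1 + γ ^ 2 * k)) * s)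
    (D' := fun s => (c - f s / slope γ (energyProfile γ c f s)) -
      (1 + c + k * (1 + γ ^ 2 * k)) * 1)
    ((hf.continuousOn_momentum_energyProfile h.speed_nonneg).sub (by fun_prop))
    (fun s hs => (hf.hasDerivAt_momentum_energyProfile h.speed_nonneg
      (Ioo_subset_Icc_self hs) (h.pos s hs)).sub ((hasDerivAt_id s).const_mul _))
    (fun s hs h0 => by
      have hs0 := hs.1
      have hy := h.pos s hs
      have hR := slope_pos (γ := γ) hy
      have h1 : s ≤ momentum γ (energyProfile γ c f s) := by
        have : 0 ≤ (c + k * (1 + γ ^ 2 * k)) * s := by positivity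
        linarith
      have h2 : momentum γ (energyProfile γ c f s) ≤
          slope γ (energyProfile γ c f s) * (1 + γ ^ 2 * k) := by
        rw [momentum_eq_slope_mul hy.le]
        have := hf.energyProfile_le_k (γ := γ) hc s (Ioo_subset_Icc_self hs)
        gcongr
      have h3 := neg_le_of_abs_le (hf.abs_le_left s (Ioo_subset_Icc_self hs))
      have h4 : -(f s / slope γ (energyProfile γ c f s)) ≤ k * (1 + γ ^ 2 * k) := by
        rw [← neg_div, div_le_iff₀ hR]
        nlinarith
      linarith)
    (by simp [h.map_zero, momentum]) s hs
  linarith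

/-- One constant serves both ends: the part before `√k` bounds the slope at `0`, and `√k` bounds it
at `1`, where `slope ≤ √(2y) ≤ √k (1 - s)`. -/
lemma isSpeedLaw (hf : IsSignedReaction f α k) (h : HasFrontEnergy γ c f) :
    IsSpeedLaw (speedLaw γ c f) (1 + c + k * (1 + γ ^ 2 * k) + √k) := by
  have hk := hf.k_pos
  have hc := h.speed_nonneg
  refine ⟨((continuous_slope γ).comp_continuousOn (hf.continuousOn_energyProfile hc)).mono
    Ioo_subset_Icc_self, fun s hs => slope_pos (h.pos s hs), fun s hs => ?_, fun s hs => ?_⟩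
  · have h1 := (slope_le_momentum γ _).trans
      (hf.momentum_energyProfile_le h s (Ioo_subset_Icc_self hs))
    have h2 : 0 ≤ √k * s := mul_nonneg (Real.sqrt_nonneg k) hs.1.le
    rw [speedLaw]; linarith
  · have h0 := h.pos s hs
    have hs1 : 0 ≤ 1 - s := sub_nonneg.2 hs.2.le
    have h1 := hf.energyProfile_le (γ := γ) hc s (Ioo_subset_Icc_self hs)
    have h2 : slope γ (energyProfile γ c f s) ≤ √k * (1 - s) := by
      refine (slope_le_sqrt h0.le).trans ?_
      rw [← Real.sqrt_sq hs1, ← Real.sqrt_mul hk.le]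
      exact Real.sqrt_le_sqrt (by linarith)
    have h3 : 0 ≤ (1 + c + k * (1 + γ ^ 2 * k)) * (1 - s) := by positivity
    rw [speedLaw]; linarith

lemma isPhaseFront_flow (hf : IsSignedReaction f α k) (h : HasFrontEnergy γ c f)
    (ha : a ∈ Ioo (0 : ℝ) 1) : IsPhaseFront γ c f (flow (speedLaw γ c f) a)
      (fun z => momentum γ (energyProfile γ c f (flow (speedLaw γ c f) a z))) := by
  have hP := hf.isSpeedLaw h
  have hd := hP.hasDerivAt_flow ha
  refine ⟨fun z => ?_, fun z => ?_, fun z => momentum_nonneg _ _, hP.tendsto_flow_atBot ha,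
    hP.tendsto_flow_atTop ha⟩
  · rw [velocity_momentum]; exact hd z
  · have hmem := hP.flow_mem ha z
    have h1 := (hf.hasDerivAt_momentum_energyProfile h.speed_nonneg
      (Ioo_subset_Icc_self hmem) (h.pos _ hmem)).comp z (hd z)
    refine h1.congr_deriv ?_
    have := slope_pos (γ := γ) (h.pos _ hmem)
    rw [velocity_momentum, speedLaw]
    field_simp

/-- Fronts with value `a` at `0` exist exactly for the admissible speeds, and are unique. -/
lemma isFront_iff (hf : IsSignedReaction f α k) (ha : a ∈ Ioo (0 : ℝ) 1) :
    IsFront γ c f v ∧ v 0 = a ↔ HasFrontEnergy γ c f ∧ v = flow (speedLaw γ c f) a := by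
  constructor
  · rintro ⟨h, rfl⟩
    have hp := h.isPhaseFront
    have hE := hp.hasFrontEnergy hf
    exact ⟨hE, (hf.isSpeedLaw hE).eq_flow (fun z => ⟨hp.fst_pos hf z, hp.fst_lt_one hf z⟩)
      (hp.hasDerivAt_slope hf)⟩
  · rintro ⟨h, rfl⟩
    exact ⟨(hf.isPhaseFront_flow h ha).isFront hf.continuous, (hf.isSpeedLaw h).flow_zero ha⟩

lemma admissibleSpeeds_eq (hf : IsSignedReaction f α k) :
    admissibleSpeeds γ f = {c | HasFrontEnergy γ c f} := by
  have ha : (1 / 2 : ℝ) ∈ Ioo (0 : ℝ) 1 := by norm_num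
  ext c
  exact ⟨fun ⟨_, hv⟩ => hv.isPhaseFront.hasFrontEnergy hf,
    fun h => ⟨_, ((hf.isFront_iff ha).2 ⟨h, rfl⟩).1⟩⟩

lemma criticalSpeed_eq (hf : IsSignedReaction f α k) (hγ : 0 ≤ γ) :
    criticalSpeed γ f = minimalSpeed γ f := by
  rw [criticalSpeed, hf.admissibleSpeeds_eq]
  exact IsLeast.csInf_eq ⟨hf.hasFrontEnergy_minimalSpeed hγ,
    fun _ h => minimalSpeed_le_of_hasFrontEnergy h⟩

lemma isTheCriticalProfile (hf : IsSignedReaction f α k) (hγ : 0 ≤ γ)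
    (ha : a ∈ Ioo (0 : ℝ) 1) : IsTheCriticalProfile γ f a (criticalProfile γ f a) := fun w => by
  rw [hf.criticalSpeed_eq hγ, hf.isFront_iff ha, criticalProfile]
  exact and_iff_right (hf.hasFrontEnergy_minimalSpeed hγ)

lemma deriv_criticalProfile (hf : IsSignedReaction f α k) (hγ : 0 ≤ γ)
    (ha : a ∈ Ioo (0 : ℝ) 1) : deriv (criticalProfile γ f a) = fun z =>
      slope γ (energyProfile γ (minimalSpeed γ f) f (criticalProfile γ f a z)) :=
  funext fun z => ((hf.isSpeedLaw (hf.hasFrontEnergy_minimalSpeed hγ)).hasDerivAt_flow ha z).deriv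

/-- Expressed through the energy, with `max` guarding the denominator, the right side is a jointly
continuous function of `γ`, the energy, the speed and `v`. -/
lemma deriv_deriv_criticalProfile (hf : IsSignedReaction f α k) (hγ : 0 ≤ γ)
    (ha : a ∈ Ioo (0 : ℝ) 1) : deriv (deriv (criticalProfile γ f a)) = fun z =>
      1 / (1 + γ ^ 2 * max (energyProfile γ (minimalSpeed γ f) f (criticalProfile γ f a z)) 0) ^ 3
        * (minimalSpeed γ f *
          slope γ (energyProfile γ (minimalSpeed γ f) f (criticalProfile γ f a z))
          - f (criticalProfile γ f a z)) := by
  have h := hf.isPhaseFront_flow (hf.hasFrontEnergy_minimalSpeed hγ) ha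
  rw [criticalProfile, h.deriv_deriv_eq]
  funext z
  rw [velocity_momentum, ← momentum_max, sqrt_one_add_momentum_sq (le_max_right _ _)]

lemma tendstoUniformlyOn_speedLaw (hf : IsSignedReaction f α k)
    (hlim : Tendsto (fun γ => minimalSpeed γ f) (𝓝[>] 0) (𝓝 (minimalSpeed 0 f))) :
    TendstoUniformlyOn (fun γ => speedLaw γ (minimalSpeed γ f) f)
      (speedLaw 0 (minimalSpeed 0 f) f) (𝓝[>] 0) (Icc 0 1) := by
  have h0 := minimalSpeed_nonneg 0 f
  have hY := hf.tendstoUniformlyOn_energyProfile h0 hlim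
    (Eventually.of_forall fun γ => minimalSpeed_nonneg γ f)
  have hid : Tendsto (fun γ : ℝ => γ) (𝓝[>] 0) (𝓝 0) := nhdsWithin_le_nhds
  have hK := (isCompact_singleton (x := (0 : ℝ))).prod
    (isCompact_Icc.image_of_continuousOn (hf.continuousOn_energyProfile (γ := 0) h0))
  have hF : TendstoUniformlyOn (fun γ s => (γ, energyProfile γ (minimalSpeed γ f) f s))
      (fun s => ((0 : ℝ), energyProfile 0 (minimalSpeed 0 f) f s)) (𝓝[>] 0) (Icc 0 1) :=
    tendstoUniformlyOn_prodMk (hid.tendstoUniformlyOn_const _) hY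
  exact tendstoUniformlyOn_continuous_comp continuous_slope_uncurry hK hF
    fun s hs => ⟨rfl, mem_image_of_mem _ hs⟩

/-- The quadruple of `γ`, energy along the profile, speed and profile converges uniformly on the
line, with limit in a compact set. Applying the continuous expressions for `v'` and `v''` preserves
uniform convergence. -/
lemma tendstoC2_criticalProfile (hf : IsSignedReaction f α k) (ha : a ∈ Ioo (0 : ℝ) 1)
    (hlim : Tendsto (fun γ => minimalSpeed γ f) (𝓝[>] 0) (𝓝 (minimalSpeed 0 f))) :
    TendstoC2 (fun γ => criticalProfile γ f a) (criticalProfile 0 f a) := by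
  have h0 := minimalSpeed_nonneg 0 f
  have hpos : ∀ᶠ γ in 𝓝[>] (0 : ℝ), 0 ≤ γ := by
    filter_upwards [self_mem_nhdsWithin] with γ hγ
    exact le_of_lt hγ
  have hid : Tendsto (fun γ : ℝ => γ) (𝓝[>] 0) (𝓝 0) := nhdsWithin_le_nhds
  have hlaw : ∀ {γ}, 0 ≤ γ → IsSpeedLaw (speedLaw γ (minimalSpeed γ f) f)
      (1 + minimalSpeed γ f + k * (1 + γ ^ 2 * k) + √k) := fun hγ =>
    hf.isSpeedLaw (hf.hasFrontEnergy_minimalSpeed hγ)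
  have hv : TendstoUniformly (fun γ => criticalProfile γ f a) (criticalProfile 0 f a)
      (𝓝[>] 0) :=
    tendstoUniformly_flow (hpos.mono fun γ hγ => hlaw hγ) (hlaw le_rfl)
      (hf.tendstoUniformlyOn_speedLaw hlim) ha
  have hmem : ∀ {γ}, 0 ≤ γ → ∀ z, criticalProfile γ f a z ∈ Icc (0 : ℝ) 1 := fun hγ z =>
    Ioo_subset_Icc_self ((hlaw hγ).flow_mem ha z)
  have hY := hf.continuousOn_energyProfile (γ := 0) h0
  have hYv : TendstoUniformly
      (fun γ z => energyProfile γ (minimalSpeed γ f) f (criticalProfile γ f a z))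
      (fun z => energyProfile 0 (minimalSpeed 0 f) f (criticalProfile 0 f a z)) (𝓝[>] 0) :=
    tendstoUniformly_comp_of_Icc (hf.tendstoUniformlyOn_energyProfile h0 hlim
      (Eventually.of_forall fun γ => minimalSpeed_nonneg γ f)) hY hv
      (hpos.mono fun γ hγ => hmem hγ) (hmem le_rfl)
  have hF : TendstoUniformlyOn
      (fun γ z => ((γ, energyProfile γ (minimalSpeed γ f) f (criticalProfile γ f a z)),
        (minimalSpeed γ f, criticalProfile γ f a z)))
      (fun z => (((0 : ℝ), energyProfile 0 (minimalSpeed 0 f) f (criticalProfile 0 f a z)),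
        (minimalSpeed 0 f, criticalProfile 0 f a z))) (𝓝[>] 0) univ :=
    tendstoUniformlyOn_prodMk
      (tendstoUniformlyOn_prodMk (hid.tendstoUniformlyOn_const _) hYv.tendstoUniformlyOn)
      (tendstoUniformlyOn_prodMk (hlim.tendstoUniformlyOn_const _) hv.tendstoUniformlyOn)
  have hK := ((isCompact_singleton (x := (0 : ℝ))).prod
    (isCompact_Icc.image_of_continuousOn hY)).prod
    ((isCompact_singleton (x := minimalSpeed 0 f)).prod (isCompact_Icc (a := (0 : ℝ)) (b := 1)))
  have hm : MapsTo
      (fun z => (((0 : ℝ), energyProfile 0 (minimalSpeed 0 f) f (criticalProfile 0 f a z)),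
        (minimalSpeed 0 f, criticalProfile 0 f a z))) univ
      (({0} ×ˢ (energyProfile 0 (minimalSpeed 0 f) f '' Icc 0 1)) ×ˢ
        ({minimalSpeed 0 f} ×ˢ Icc 0 1)) := fun z _ =>
    ⟨⟨rfl, mem_image_of_mem _ (hmem le_rfl z)⟩, rfl, hmem le_rfl z⟩
  -- The derivative formulas are available only for `γ ≥ 0`, which holds eventually in `𝓝[>] 0` and
  -- at the limit value.
  have hcongr : ∀ {F : ℝ → ℝ → ℝ} {G : ℝ → ℝ → ℝ}, (∀ γ, 0 ≤ γ → F γ = G γ) →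
      TendstoUniformlyOn G (G 0) (𝓝[>] 0) univ →
      TendstoUniformly F (F 0) (𝓝[>] 0) := fun {F G} hFG hG => by
    rw [hFG 0 le_rfl, ← tendstoUniformlyOn_univ]
    refine hG.congr ?_
    filter_upwards [hpos] with γ hγ z _
    rw [hFG γ hγ]
  intro n hn
  interval_cases n
  · simpa only [iteratedDeriv_zero] using hv
  · simp only [iteratedDeriv_one]
    have h1 := tendstoUniformlyOn_continuous_comp
      (G := fun p : (ℝ × ℝ) × ℝ × ℝ => slope p.1.1 p.1.2)
      (continuous_slope_uncurry.comp continuous_fst) hK hF hm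
    exact hcongr (F := fun γ => deriv (criticalProfile γ f a))
      (fun γ hγ => hf.deriv_criticalProfile hγ ha) h1
  · simp only [iteratedDeriv_succ, iteratedDeriv_zero]
    have hG : Continuous fun p : (ℝ × ℝ) × ℝ × ℝ => 1 / (1 + p.1.1 ^ 2 * max p.1.2 0) ^ 3 *
        (p.2.1 * slope p.1.1 p.1.2 - f p.2.2) := by
      refine Continuous.mul (Continuous.div continuous_const (by fun_prop) fun p => ?_)
        (((continuous_fst.comp continuous_snd).mul
          (continuous_slope_uncurry.comp continuous_fst)).sub
          (hf.continuous.comp (continuous_snd.comp continuous_snd)))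
      have : 0 ≤ max p.1.2 0 := le_max_right _ _
      positivity
    have h1 := tendstoUniformlyOn_continuous_comp hG hK hF hm
    exact hcongr (F := fun γ => deriv (deriv (criticalProfile γ f a)))
      (fun γ hγ => hf.deriv_deriv_criticalProfile hγ ha) h1

end IsSignedReaction

end BornInfeld

namespace BornInfeld

/-! ### Transfer to reaction terms on `[0, 1]` and to linear fronts. -/

variable {f g v : ℝ → ℝ} {α k γ c a m : ℝ}

lemma IsConnection.mem_Icc (h : IsConnection v) (z : ℝ) : v z ∈ Icc (0 : ℝ) 1 :=
  ⟨h.monotone.le_of_tendsto h.tendsto_atBot z, h.monotone.ge_of_tendsto h.tendsto_atTop z⟩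

lemma IsFront.congr (hfg : EqOn f g (Icc 0 1)) (h : IsFront γ c f v) : IsFront γ c g v :=
  ⟨h.toIsConnection, h.field_lt, fun z => by
    rw [← hfg (h.toIsConnection.mem_Icc z)]; exact h.equation z⟩

lemma isFront_congr (hfg : EqOn f g (Icc 0 1)) : IsFront γ c f v ↔ IsFront γ c g v :=
  ⟨IsFront.congr hfg, IsFront.congr hfg.symm⟩

/-- This turns every result proved for `0 ≤ γ` into one about linear diffusion. -/
lemma isFront_zero_iff : IsFront 0 c f v ↔ IsLinearFront c f v := by
  refine ⟨fun h => ⟨h.toIsConnection, fun z => ?_⟩,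
    fun h => ⟨h.toIsConnection, fun z => by norm_num, fun z => ?_⟩⟩
  · simpa using h.equation z
  · simpa using h.equation z

lemma admissibleSpeeds_congr (hfg : EqOn f g (Icc 0 1)) :
    admissibleSpeeds γ f = admissibleSpeeds γ g := by
  simp only [admissibleSpeeds, isFront_congr hfg]

lemma criticalSpeed_congr (hfg : EqOn f g (Icc 0 1)) :
    criticalSpeed γ f = criticalSpeed γ g := by
  rw [criticalSpeed, criticalSpeed, admissibleSpeeds_congr hfg]

lemma linearAdmissibleSpeeds_eq (f : ℝ → ℝ) :
    linearAdmissibleSpeeds f = admissibleSpeeds 0 f := by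
  simp only [admissibleSpeeds, linearAdmissibleSpeeds, isFront_zero_iff]

lemma linearCriticalSpeed_eq (f : ℝ → ℝ) : linearCriticalSpeed f = criticalSpeed 0 f := by
  rw [criticalSpeed, linearCriticalSpeed, linearAdmissibleSpeeds_eq]

lemma IsTheCriticalProfile.congr (hfg : EqOn f g (Icc 0 1))
    (h : IsTheCriticalProfile γ g a v) : IsTheCriticalProfile γ f a v := fun w => by
  rw [criticalSpeed_congr hfg, isFront_congr hfg]; exact h w

lemma IsTheCriticalProfile.linear (h : IsTheCriticalProfile 0 f a v) :
    IsTheLinearCriticalProfile f a v := fun w => by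
  rw [linearCriticalSpeed_eq, ← isFront_zero_iff]; exact h w

/-- Existence, uniqueness and convergence of the critical profiles. -/
lemma exists_criticalProfiles (hg : IsSignedReaction g α k) (hfg : EqOn f g (Icc 0 1))
    (ha : a ∈ Ioo (0 : ℝ) 1)
    (hlim : Tendsto (fun γ => minimalSpeed γ g) (𝓝[>] 0) (𝓝 (minimalSpeed 0 g))) :
    Tendsto (fun γ => criticalSpeed γ f) (𝓝[>] 0) (𝓝 (linearCriticalSpeed f)) ∧
    ∃ (v : ℝ → ℝ → ℝ) (vL : ℝ → ℝ), (∀ γ : ℝ, 0 < γ → IsTheCriticalProfile γ f a (v γ)) ∧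
      IsTheLinearCriticalProfile f a vL ∧ TendstoC2 v vL := by
  have hcrit : ∀ {γ}, 0 ≤ γ → criticalSpeed γ f = minimalSpeed γ g := fun hγ => by
    rw [criticalSpeed_congr hfg, hg.criticalSpeed_eq hγ]
  refine ⟨?_, fun γ => criticalProfile γ g a, criticalProfile 0 g a,
    fun γ hγ => (hg.isTheCriticalProfile hγ.le ha).congr hfg,
    ((hg.isTheCriticalProfile le_rfl ha).congr hfg).linear, hg.tendstoC2_criticalProfile ha hlim⟩
  rw [linearCriticalSpeed_eq, hcrit le_rfl]
  refine hlim.congr' ?_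
  filter_upwards [self_mem_nhdsWithin] with γ hγ
  exact (hcrit (le_of_lt hγ)).symm

lemma admissibleSpeeds_eq_of_congr (hg : IsSignedReaction g α k) (hfg : EqOn f g (Icc 0 1)) :
    admissibleSpeeds γ f = {c | HasFrontEnergy γ c g} := by
  rw [admissibleSpeeds_congr hfg, hg.admissibleSpeeds_eq]

lemma criticalSpeed_eq_of_congr (hg : IsSignedReaction g α k) (hfg : EqOn f g (Icc 0 1))
    (hγ : 0 ≤ γ) : criticalSpeed γ f = minimalSpeed γ g := by
  rw [criticalSpeed_congr hfg, hg.criticalSpeed_eq hγ]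

lemma admissibleSpeeds_eq_Ici (hg : IsSignedReaction g 0 k) (hfg : EqOn f g (Icc 0 1))
    (hγ : 0 ≤ γ) : admissibleSpeeds γ f = Ici (criticalSpeed γ f) := by
  rw [admissibleSpeeds_eq_of_congr hg hfg, criticalSpeed_eq_of_congr hg hfg hγ]
  ext c
  exact hg.hasFrontEnergy_iff_of_monostable hγ

lemma admissibleSpeeds_eq_singleton (hg : IsSignedReaction g α k) (hfg : EqOn f g (Icc 0 1))
    (hα : 0 < α) (hγ : 0 ≤ γ) : admissibleSpeeds γ f = {criticalSpeed γ f} := by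
  rw [admissibleSpeeds_eq_of_congr hg hfg, criticalSpeed_eq_of_congr hg hfg hγ]
  ext c
  exact hg.hasFrontEnergy_iff_eq hα hγ

/-- A reaction term with the appropriate signs agrees on `[0, 1]` with a continuous one. -/
lemma IsReactionTerm.exists_isSignedReaction (hf : IsReactionTerm f) (hα : α ∈ Ico (0 : ℝ) 1)
    (hnonpos : ∀ s ∈ Icc 0 α, f s ≤ 0) (hpos : ∀ s ∈ Ioo α 1, 0 < f s)
    (hint : 0 ≤ ∫ s in (0 : ℝ)..1, f s) (hint' : ∀ s ∈ Ioo (0 : ℝ) 1, 0 < ∫ t in s..1, f t) :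
    ∃ g k, IsSignedReaction g α k ∧ EqOn f g (Icc 0 1) := by
  obtain ⟨k, hk, hb⟩ := hf.linear_control
  -- Extension by the boundary values of `f`; fronts take values in `[0, 1]` and do not see the
  -- change.
  have heq : EqOn f (IccExtend zero_le_one ((Icc (0 : ℝ) 1).domRestrict f)) (Icc 0 1) :=
    fun s hs => by simp [IccExtend_of_mem _ _ hs, Set.domRestrict]
  have hI : ∀ s ∈ Icc (0 : ℝ) 1, (∫ t in s..1, f t) =
      ∫ t in s..1, IccExtend zero_le_one ((Icc (0 : ℝ) 1).domRestrict f) t := fun s hs => by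
    apply intervalIntegral.integral_congr
    rw [uIcc_of_le hs.2]
    exact heq.mono (Icc_subset_Icc_left hs.1)
  have hsub : Icc 0 α ⊆ Icc 0 1 := Icc_subset_Icc_right hα.2.le
  have hsub' : Ioo α 1 ⊆ Icc 0 1 := Ioo_subset_Icc_self.trans (Icc_subset_Icc_left hα.1)
  exact ⟨_, k, ⟨hf.continuousOn.domRestrict.Icc_extend', hα,
    fun s hs => heq (hsub hs) ▸ hnonpos s hs, fun s hs => heq (hsub' hs) ▸ hpos s hs,
    hI 0 (by norm_num) ▸ hint, fun s hs => hI s (Ioo_subset_Icc_self hs) ▸ hint' s hs, hk,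
    fun s hs => heq hs ▸ (hb s hs).1, fun s hs => heq hs ▸ (hb s hs).2⟩, heq⟩

lemma IsReactionTerm.intervalIntegrable (hf : IsReactionTerm f) {a b : ℝ}
    (ha : a ∈ Icc (0 : ℝ) 1) (hb : b ∈ Icc (0 : ℝ) 1) : IntervalIntegrable f volume a b :=
  (hf.continuousOn.mono (ordConnected_Icc.uIcc_subset ha hb)).intervalIntegrable

lemma IsReactionTerm.integral_pos_right (hf : IsReactionTerm f) (hα : 0 ≤ α)
    (hpos : ∀ s ∈ Ioo α 1, 0 < f s) {s : ℝ} (hs : s ∈ Ico α 1) : 0 < ∫ t in s..1, f t :=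
  intervalIntegral.intervalIntegral_pos_of_pos_on
    (hf.intervalIntegrable ⟨hα.trans hs.1, hs.2.le⟩ (by norm_num))
    (fun t ht => hpos t ⟨hs.1.trans_lt ht.1, ht.2⟩) hs.2

lemma TypeA.exists_isSignedReaction (h : TypeA f) (hf : IsReactionTerm f) :
    ∃ g k, IsSignedReaction g 0 k ∧ EqOn f g (Icc 0 1) := by
  refine hf.exists_isSignedReaction (by norm_num) (fun s hs => ?_) h
    (hf.integral_pos_right le_rfl h (by norm_num)).le
    fun s hs => hf.integral_pos_right le_rfl h ⟨hs.1.le, hs.2⟩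
  rw [Icc_self] at hs
  rw [hs, hf.map_zero]

lemma TypeB.exists_isSignedReaction (h : TypeB f α) (hf : IsReactionTerm f) :
    ∃ g k, IsSignedReaction g α k ∧ EqOn f g (Icc 0 1) := by
  obtain ⟨hα, hzero, hpos⟩ := h
  have hint : ∀ s ∈ Ico (0 : ℝ) 1, 0 < ∫ t in s..1, f t := by
    intro s hs
    rcases le_or_gt α s with hle | hlt
    · exact hf.integral_pos_right hα.1.le hpos ⟨hle, hs.2⟩
    · have hα' := Ioo_subset_Icc_self hα
      have h1 : ∫ t in s..α, f t = 0 := by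
        rw [intervalIntegral.integral_congr (g := fun _ => 0) fun t ht => ?_]
        · simp
        · rw [uIcc_of_le hlt.le] at ht
          exact hzero t ⟨hs.1.trans ht.1, ht.2⟩
      rw [← intervalIntegral.integral_add_adjacent_intervals
        (hf.intervalIntegrable ⟨hs.1, hs.2.le⟩ hα')
        (hf.intervalIntegrable hα' (by norm_num)), h1, zero_add]
      exact hf.integral_pos_right hα.1.le hpos ⟨le_rfl, hα.2⟩
  exact hf.exists_isSignedReaction ⟨hα.1.le, hα.2⟩ (fun s hs => (hzero s hs).le) hpos
    (hint 0 (by norm_num)).le fun s hs => hint s ⟨hs.1.le, hs.2⟩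

lemma TypeC.exists_isSignedReaction (h : TypeC f α) (hf : IsReactionTerm f) :
    ∃ g k, IsSignedReaction g α k ∧ EqOn f g (Icc 0 1) := by
  obtain ⟨hα, hneg, hpos, hint⟩ := h
  refine hf.exists_isSignedReaction ⟨hα.1.le, hα.2⟩ (fun s hs => ?_) hpos hint fun s hs => ?_
  -- The sign is assumed only on the open interval; continuity carries it to the endpoints.
  · have hcl : Icc 0 α ⊆ closure (Ioo 0 α) := by rw [closure_Ioo hα.1.ne]
    have hsub : Icc 0 α ⊆ Icc 0 1 := Icc_subset_Icc_right hα.2.le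
    exact ContinuousWithinAt.closure_le (hcl hs)
      ((hf.continuousOn s (hsub hs)).mono (Ioo_subset_Icc_self.trans hsub))
      continuousWithinAt_const fun t ht => (hneg t ht).le
  · rcases le_or_gt α s with hle | hlt
    · exact hf.integral_pos_right hα.1.le hpos ⟨hle, hs.2⟩
    · have hs' := Ioo_subset_Icc_self hs
      -- For `s < α` the integral over `[0, s]` is negative, so the one over `[s, 1]` strictly
      -- exceeds the total, which is nonnegative.
      have h1 := intervalIntegral.intervalIntegral_pos_of_pos_on (f := fun t => -f t)
        (hf.intervalIntegrable (by norm_num) hs').neg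
        (fun t ht => neg_pos.2 (hneg t ⟨ht.1, ht.2.trans hlt⟩)) hs.1
      rw [intervalIntegral.integral_neg] at h1
      have h2 := intervalIntegral.integral_add_adjacent_intervals (a := 0) (c := 1)
        (hf.intervalIntegrable (by norm_num) hs') (hf.intervalIntegrable hs' (by norm_num))
      linarith

lemma KPP.pos (h : KPP f m) : 0 < m := by
  have h1 := h.1 (1 / 2) (by norm_num)
  have h2 := h.2.2 (1 / 2) (by norm_num)
  linarith

end BornInfeld

theorem mainTheorem5 (f : ℝ → ℝ) (hf : BornInfeld.IsReactionTerm f) :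
    (∀ m : ℝ, BornInfeld.KPP f m →
      (∀ γ : ℝ, 0 < γ →
        BornInfeld.admissibleSpeeds γ f = Set.Ici (BornInfeld.criticalSpeed γ f)) ∧
      BornInfeld.linearAdmissibleSpeeds f = Set.Ici (BornInfeld.linearCriticalSpeed f) ∧
      BornInfeld.linearCriticalSpeed f = 2 * √m ∧
      Tendsto (fun γ => BornInfeld.criticalSpeed γ f) (𝓝[>] (0 : ℝ))
        (𝓝 (BornInfeld.linearCriticalSpeed f)) ∧
      ∃ (v : ℝ → ℝ → ℝ) (vL : ℝ → ℝ),
        (∀ γ : ℝ, 0 < γ → BornInfeld.IsTheCriticalProfile γ f (1 / 2) (v γ)) ∧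
        BornInfeld.IsTheLinearCriticalProfile f (1 / 2) vL ∧
        BornInfeld.TendstoC2 v vL) ∧
    (∀ α : ℝ, BornInfeld.TypeB f α ∨ BornInfeld.TypeC f α →
      (∀ γ : ℝ, 0 < γ →
        BornInfeld.admissibleSpeeds γ f = {BornInfeld.criticalSpeed γ f}) ∧
      BornInfeld.linearAdmissibleSpeeds f = {BornInfeld.linearCriticalSpeed f} ∧
      Tendsto (fun γ => BornInfeld.criticalSpeed γ f) (𝓝[>] (0 : ℝ))
        (𝓝 (BornInfeld.linearCriticalSpeed f)) ∧
      ∃ (v : ℝ → ℝ → ℝ) (vL : ℝ → ℝ),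
        (∀ γ : ℝ, 0 < γ → BornInfeld.IsTheCriticalProfile γ f α (v γ)) ∧
        BornInfeld.IsTheLinearCriticalProfile f α vL ∧
        BornInfeld.TendstoC2 v vL) := by

  refine ⟨fun m hm => ?_, fun α hα => ?_⟩
  · obtain ⟨g, k, hg, hfg⟩ := hm.1.exists_isSignedReaction hf
    have h0 : (0 : ℝ) ∈ Icc (0 : ℝ) 1 := by norm_num
    obtain ⟨hval, hlim⟩ := hg.tendsto_minimalSpeed_kpp
      (hm.2.1.congr (fun s hs => (hfg hs).symm) (hfg h0).symm) (hfg h0 ▸ hf.map_zero) hm.pos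
      fun s hs => hfg hs ▸ hm.2.2 s hs
    refine ⟨fun γ hγ => BornInfeld.admissibleSpeeds_eq_Ici hg hfg hγ.le, ?_, ?_,
      BornInfeld.exists_criticalProfiles hg hfg (by norm_num) hlim⟩
    · rw [BornInfeld.linearAdmissibleSpeeds_eq, BornInfeld.linearCriticalSpeed_eq]
      exact BornInfeld.admissibleSpeeds_eq_Ici hg hfg le_rfl
    · rw [BornInfeld.linearCriticalSpeed_eq,
        BornInfeld.criticalSpeed_eq_of_congr hg hfg le_rfl, hval]
  · have hmem : α ∈ Ioo (0 : ℝ) 1 := hα.elim (fun h => h.1) fun h => h.1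
    obtain ⟨g, k, hg, hfg⟩ := hα.elim (fun h => h.exists_isSignedReaction hf)
      fun h => h.exists_isSignedReaction hf
    refine ⟨fun γ hγ => BornInfeld.admissibleSpeeds_eq_singleton hg hfg hmem.1 hγ.le, ?_,
      BornInfeld.exists_criticalProfiles hg hfg hmem (hg.tendsto_minimalSpeed hmem.1)⟩
    rw [BornInfeld.linearAdmissibleSpeeds_eq, BornInfeld.linearCriticalSpeed_eq]
    exact BornInfeld.admissibleSpeeds_eq_singleton hg hfg hmem.1 le_rfl
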